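/- **Notation.** For a real random variable $X$ put $\|X\|_{\psi_2}=\inf\{t>0:\mathbb E\exp((X/t)^2)\le 2\}$. For $T\ge 1$, $G_n(T)$ is the class of random vectors $\xi=(\xi_1,\dots,\xi_n)$ with independent (not necessarily identically distributed) real coordinates, each of mean $0$, variance $1$ and $\|\xi_i\|_{\psi_2}\le T$. For $\mu\in(0,1]$ and a random vector $\eta$ of length $d$, $\tau\in\Phi_\mu(d,\eta)$ means $\tau_j=\delta_j\eta_j$ for $j=1,\dots,d$, where $\delta_1,\dots,\delta_d$ are i.i.d. with $\mathbb P(\delta_j=1)=\mu$, $\mathbb P(\delta_j=0)=1-\mu$, and are independent of $\eta$. For a random vector $X$ in $\mathbb R^l$, $\mathcal L(X,t)=\sup_{w\in\mathbb R^l}\mathbb P(\|X-w\|_2\le t)$. For $x\in\mathbb R^n$ put $\|x\|_\xi=\big(\mathbb E\,\mathrm{dist}(x\star(\xi-\xi'),\mathbb Z^n)^2\big)^{1/2}$, where $\xi'$ is an independent copy of $\xi$, $\star$ is the coordinatewise product and $\mathrm{dist}$ is the Euclidean distance. For an $n\times m$ matrix $Y$ with columns $Y_1,\dots,Y_m$,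 for $L>0$ and $\alpha\in(0,1)$, put $$\mathrm{RlogD}^{\xi}_{L,\alpha}(Y)=\inf\Big\{\|\theta\|_2:\ \theta\in\mathbb R^m,\ \|Y\theta\|_\xi<L\sqrt{\log_+\frac{\alpha\|\theta\|_Y}{L}}\Big\},\qquad \|\theta\|_Y=\Big(\sum_{i=1}^m\|Y_i\|_2^2\theta_i^2\Big)^{1/2},$$ with $\log_+ x=\max(\log x,0)$, $\log_+0=0$ and $\inf\emptyset=\infty$. For a $2n\times k$ matrix $W$ put $$W_Y=\begin{bmatrix}W&\begin{bmatrix}Y\\ 0\end{bmatrix}&\begin{bmatrix}0\\ Y\end{bmatrix}\end{bmatrix},$$ a $2n\times(k+2m)$ matrix. $\|W\|$ is the operator norm and $\|W\|_{\mathrm{HS}}$ the Hilbert–Schmidt norm. **Theorem.** There exist absolute constants $d,c,C>0$ such that the following holds. Let $T\ge1$, $n,k\in\mathbb N$ (with $0\in\mathbb N$), $m\in\mathbb N^+$, $\alpha\in(0,1)$ and $\mu\in(0,1]$. Let $\xi\in G_n(T)$, let $\xi'$ be an independent copy of $\xi$, $\eta=(\xi,\xi')$ and $\tau\in\Phi_\mu(2n,\eta)$.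 Let $Y$ be a real $n\times m$ matrix with nonzero columns $Y_1,\dots,Y_m$, $y_i=\|Y_i\|_2$, and let $W$ be a real $2n\times k$ matrix with $\|W\|\le2$ and $\|W\|_{\mathrm{HS}}\ge\sqrt k/2$. Let $\gamma\ge d\,T^2\mu^{-1/2}$, $L=\gamma\sqrt m$ and $0<c_0<c\,T^{-4}\mu$. If $\mathrm{RlogD}^{\xi}_{L,\alpha}(Y)>16\sqrt m$, then $$\mathcal L\big(W_Y^{T}\tau,\ c_0^{1/2}\sqrt{k+m}\big)\le\frac{R^{2m}}{\prod_{i=1}^m y_i^2}\,e^{-c_0k},\qquad R=C\gamma\alpha^{-1}.$$ -/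

import Mathlib

open MeasureTheory ProbabilityTheory

open scoped ENNReal

noncomputable section

namespace SmallBall

/-- The subgaussian norm `inf {t > 0 : E exp ((X / t) ^ 2) ≤ 2}`, equal to `∞` if there is no
such `t`. -/
def psi2Norm {Ω : Type*} [MeasurableSpace Ω] (P : Measure Ω) (X : Ω → ℝ) : ℝ≥0∞ :=
  ⨅ (t : ℝ) (_ : 0 < t) (_ : ∫⁻ ω, ENNReal.ofReal (Real.exp ((X ω / t) ^ 2)) ∂P ≤ 2),
    ENNReal.ofReal t

/-- The class `S₂(T)`: real random variables with mean `0`, variance `1` and subgaussian norm at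
most `T`. -/
structure MemS2 {Ω : Type*} [MeasurableSpace Ω] (P : Measure Ω) (T : ℝ) (X : Ω → ℝ) : Prop where
  aemeasurable : AEMeasurable X P
  mean_eq_zero : ∫ ω, X ω ∂P = 0
  variance_eq_one : variance X P = 1
  psi2Norm_le : psi2Norm P X ≤ ENNReal.ofReal T

/-- The class `G_n(T)`: random vectors of length `n` with independent coordinates, all of them
in `S₂(T)` (they need not have the same law). -/
structure MemG {Ω : Type*} [MeasurableSpace Ω] (P : Measure Ω) {n : ℕ} (T : ℝ)
    (ξ : Ω → Fin n → ℝ) : Prop where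
  indep : iIndepFun (fun i ω => ξ ω i) P
  memS2 : ∀ i, MemS2 P T (fun ω => ξ ω i)

/-- `ξ'` is an independent copy of the random vector `ξ`. -/
structure IsIndepCopy {Ω : Type*} [MeasurableSpace Ω] (P : Measure Ω) {n : ℕ}
    (ξ ξ' : Ω → Fin n → ℝ) : Prop where
  identDistrib : IdentDistrib ξ' ξ P P
  indep : IndepFun ξ ξ' P

/-- The concatenation `(ξ, ξ')`, a random vector of length `2n`. The index set `{1, …, 2n}` is
represented by `Fin n ⊕ Fin n`: the first half, then the second half. -/
def pairVec {Ω : Type*} {n : ℕ} (ξ ξ' : Ω → Fin n → ℝ) : Ω → Fin n ⊕ Fin n → ℝ :=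
  fun ω => Sum.elim (ξ ω) (ξ' ω)

/-- `τ ∈ Φ_μ(ι, η)`: `τ_j = δ_j η_j`, where the `δ_j` are independent Bernoulli variables,
`P(δ_j = 1) = μ` and `P(δ_j = 0) = 1 - μ`, and `(δ_j)_j` is independent of `η`. -/
def MemPhi {Ω : Type*} [MeasurableSpace Ω] (P : Measure Ω) {ι : Type*} (μ : ℝ)
    (η τ : Ω → ι → ℝ) : Prop :=
  ∃ δ : Ω → ι → ℝ,
    (∀ j, AEMeasurable (fun ω => δ ω j) P) ∧
    (∀ j, P {ω | δ ω j = 1} = ENNReal.ofReal μ ∧ P {ω | δ ω j = 0} = ENNReal.ofReal (1 - μ)) ∧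
    iIndepFun (fun j ω => δ ω j) P ∧
    IndepFun δ η P ∧
    ∀ j, ∀ᵐ ω ∂P, τ ω j = δ ω j * η ω j

/-- The Lévy concentration function `sup_w P(‖X - w‖₂ ≤ t)`. -/
def levy {Ω : Type*} [MeasurableSpace Ω] (P : Measure Ω) {ι : Type*} [Fintype ι]
    (X : Ω → EuclideanSpace ℝ ι) (t : ℝ) : ℝ :=
  ⨆ w : EuclideanSpace ℝ ι, P.real {ω | ‖X ω - w‖ ≤ t}

/-- The lattice `ℤⁿ` in Euclidean space. -/
def intLattice (n : ℕ) : Set (EuclideanSpace ℝ (Fin n)) :=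
  {z | ∃ a : Fin n → ℤ, ∀ i, z i = a i}

/-- `‖x‖_ξ = (E dist(x ⋆ (ξ - ξ'), ℤⁿ)²)^{1/2}`, with `ξ'` an independent copy of `ξ`; the pair
`(ξ, ξ')` is realised on the product space, and `⋆` is the coordinatewise product. -/
def xiNorm {Ω : Type*} [MeasurableSpace Ω] (P : Measure Ω) {n : ℕ} (ξ : Ω → Fin n → ℝ)
    (x : Fin n → ℝ) : ℝ :=
  √(∫ p : Ω × Ω,
    Metric.infDist (WithLp.toLp 2 fun i => x i * (ξ p.1 i - ξ p.2 i)) (intLattice n) ^ 2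
      ∂(P.prod P))

/-- `‖θ‖_V = (∑ i, ‖V_i‖₂² θ_i²)^{1/2}`, with `V_1, …, V_m` the rows of the `m × n` matrix `V`. -/
def rowWeightedNorm {m n : ℕ} (V : Matrix (Fin m) (Fin n) ℝ) (θ : Fin m → ℝ) : ℝ :=
  √(∑ i, ‖WithLp.toLp 2 (V.row i)‖ ^ 2 * θ i ^ 2)

/-- The randomized logarithmic least common denominator of the `m × n` matrix `V`:
the infimum of `‖θ‖₂` over `θ ∈ ℝᵐ` with `‖Vᵀ θ‖_ξ < L √(log₊ (α ‖θ‖_V / L))`. The infimum of the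
empty set is `∞`. -/
def RlogD {Ω : Type*} [MeasurableSpace Ω] (P : Measure Ω) {m n : ℕ} (ξ : Ω → Fin n → ℝ)
    (L α : ℝ) (V : Matrix (Fin m) (Fin n) ℝ) : ℝ≥0∞ :=
  ⨅ (θ : Fin m → ℝ)
    (_ : xiNorm P ξ (Matrix.mulVec V.transpose θ) <
      L * √(Real.posLog (α * rowWeightedNorm V θ / L))),
    ENNReal.ofReal ‖WithLp.toLp 2 θ‖

/-- The operator norm of a real matrix with respect to the Euclidean norms. -/
def opNorm {ι κ : Type*} [Fintype ι] [Fintype κ] [DecidableEq κ] (W : Matrix ι κ ℝ) : ℝ :=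
  ‖(Matrix.toEuclideanLin W).toContinuousLinearMap‖

/-- The Hilbert–Schmidt norm of a real matrix. -/
def hsNorm {ι κ : Type*} [Fintype ι] [Fintype κ] (W : Matrix ι κ ℝ) : ℝ :=
  √(∑ i, ∑ j, W i j ^ 2)

/-- The `2n × (k + 2m)` matrix `[W | (Y; 0) | (0; Y)]`. -/
def blockExtend {n k m : ℕ} (W : Matrix (Fin n ⊕ Fin n) (Fin k) ℝ) (Y : Matrix (Fin n) (Fin m) ℝ) :
    Matrix (Fin n ⊕ Fin n) (Fin k ⊕ (Fin m ⊕ Fin m)) ℝ :=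
  Matrix.fromCols W (Matrix.fromBlocks Y 0 0 Y)

end SmallBall

end

/-! Esseen's inequality with a Gaussian weight bounds the concentration function by the integral of
`exp (-π|x|²)` times the modulus of the characteristic function. Independence and symmetrisation
bound that modulus by `exp (-4μ D)`, where `D = sqDist` is the squared `ξ`-norm summed over the two
halves of the `2n` coordinates. After shrinking the `W`-block to `A = s • W` (which only increases
concentration), it remains to bound the Gaussian integral of `exp (-p D(Ax + Bθ))`, where `p = 4μ`,
`x ∈ ℝᵏ`, `θ ∈ ℝ²ᵐ`, `B = Y ⊕ Y`.

Everything rests on the quasi-triangle inequality `D(u + v) ≤ 2D(u) + 2D(v)`, used in two ways.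

Decoupling (`exists_lintegral_decouple_le`): let `θ` range over a unit cube and let `(x₀, θ₀)`
nearly minimise `D(Ax + Bθ)` plus a small multiple of `|x|²`. Then `D(B(θ - θ₀))` is controlled by
that functional at any `(x, θ)`. A 1/256 share of the exponent therefore pays for a factor in `θ`
alone, and the rest is integrated over `x` with `θ` as a mere shift.

Gain in `k` (`lintegral_gaussian_exp_neg_sqDist_le`): small rows keep `D` close to quadratic on
average, so the Gaussian mean of `D(Ax + v)` is of order `‖A‖²_HS` for every shift `v`. Jensen turns
this into a lower bound for the exponential moment of `+D/2`, and Prékopa–Leindler, using the strong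
log-concavity of the Gaussian, converts it into an upper bound for that of `-D`.

Volume in `m` (`lintegral_cube_exp_neg_sqDist_le`): the hypothesis on `RlogD` makes `D(Yz)` at least
logarithmic for `|z| ≤ √m`, so the `θ`-factor is dominated by a product of Cauchy densities, whose
integral is `(2πγ/α)^(2m) / ∏ yᵢ²`. -/

namespace SmallBall

/-! ### Brunn–Minkowski and Prékopa–Leindler at the midpoint. -/

open scoped Pointwise in
/-- The one-dimensional Brunn–Minkowski inequality, for midpoints. -/
theorem volume_add_le_two_mul_of_midpoint_mem {A B S : Set ℝ} (hA : MeasurableSet A)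
    (hB : MeasurableSet B) (hAne : A.Nonempty) (hBne : B.Nonempty)
    (hS : ∀ x ∈ A, ∀ y ∈ B, (x + y) / 2 ∈ S) :
    volume A + volume B ≤ 2 * volume S := by
  have key : ∀ K ⊆ A, IsCompact K → ∀ M ⊆ B, IsCompact M → K.Nonempty → M.Nonempty →
      volume K + volume M ≤ 2 * volume S := by
    intro K hKA hK M hMB hM hKne hMne
    obtain ⟨a, haK, ha⟩ := hK.exists_isGreatest hKne
    obtain ⟨b, hbM, hb⟩ := hM.exists_isLeast hMne
    -- With `a = max K` and `b = min M`, the translates `K + b` and `a + M` lie on opposite sides of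
    -- `a + b`, so their measures add up inside `K + M`.
    have hsub : (fun x => x + b) '' K ∪ (fun x => a + x) '' M ⊆ (2 : ℝ) • S := by
      rintro _ (⟨x, hx, rfl⟩ | ⟨x, hx, rfl⟩)
      · exact ⟨_, hS x (hKA hx) b (hMB hbM), by simp only [smul_eq_mul]; ring⟩
      · exact ⟨_, hS a (hKA haK) x (hMB hx), by simp only [smul_eq_mul]; ring⟩
    have hinter : volume ((fun x => x + b) '' K ∩ (fun x => a + x) '' M) = 0 := by
      refine measure_mono_null (t := {a + b}) ?_ (by simp)
      rintro _ ⟨⟨x, hx, rfl⟩, ⟨y, hy, hxy⟩⟩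
      have h1 := ha hx
      have h2 := hb hy
      simp only at hxy
      simp only [Set.mem_singleton_iff]
      linarith
    have hMm : MeasurableSet ((fun x => a + x) '' M) :=
      (hM.image (by fun_prop)).measurableSet
    have hun := measure_union_add_inter (μ := volume) ((fun x => x + b) '' K) hMm
    rw [hinter, add_zero] at hun
    have e1 : volume ((fun x => x + b) '' K) = volume K := by simp
    have e2 : volume ((fun x => a + x) '' M) = volume M := by simp
    have e3 : volume ((2 : ℝ) • S) = 2 * volume S := by
      simp [Measure.addHaar_smul]
    rw [← e1, ← e2, ← hun, ← e3]
    exact measure_mono hsub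
  obtain ⟨a, ha⟩ := hAne
  obtain ⟨b, hb⟩ := hBne
  rw [hA.measure_eq_iSup_isCompact, hB.measure_eq_iSup_isCompact]
  simp only [iSup_and']
  refine ENNReal.biSup_add_biSup_le' ⟨∅, by simp⟩ ⟨∅, by simp⟩ fun K hK M hM => ?_
  -- Inner regularity also ranges over empty compacts, to which `key` does not apply; adjoining a
  -- point of `A` and of `B` makes both nonempty.
  calc volume K + volume M ≤ volume (insert a K) + volume (insert b M) := by
        gcongr <;> exact Set.subset_insert _ _
    _ ≤ _ := key _ (Set.insert_subset ha hK.1) (hK.2.insert a) _ (Set.insert_subset hb hM.1)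
        (hM.2.insert b) ⟨a, by simp⟩ ⟨b, by simp⟩

/-- Layer cake, with Brunn–Minkowski applied at each height. Giving `f` and `g` the common supremum
1 makes their superlevel sets nonempty for exactly the same heights; Brunn–Minkowski fails when just
one set is empty. -/
theorem lintegral_ofReal_add_le_of_midpoint {f g h : ℝ → ℝ} (hf : Measurable f)
    (hg : Measurable g) (hh : Measurable h) (hf0 : 0 ≤ f) (hg0 : 0 ≤ g) (hh0 : 0 ≤ h)
    (hf1 : ∀ x, f x ≤ 1) (hg1 : ∀ x, g x ≤ 1)
    (hfs : ∀ t < 1, ∃ x, t < f x) (hgs : ∀ t < 1, ∃ x, t < g x)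
    (H : ∀ x y t, 0 < t → t < f x → t < g y → t < h ((x + y) / 2)) :
    (∫⁻ x, ENNReal.ofReal (f x)) + (∫⁻ x, ENNReal.ofReal (g x)) ≤
      2 * ∫⁻ x, ENNReal.ofReal (h x) := by
  rw [lintegral_eq_lintegral_meas_lt _ (ae_of_all _ hf0) hf.aemeasurable,
    lintegral_eq_lintegral_meas_lt _ (ae_of_all _ hg0) hg.aemeasurable,
    lintegral_eq_lintegral_meas_lt _ (ae_of_all _ hh0) hh.aemeasurable]
  have hanti : ∀ p : ℝ → ℝ, Measurable fun t => volume {a : ℝ | t < p a} := fun p =>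
    Antitone.measurable fun s t hst => measure_mono fun a ha => lt_of_le_of_lt hst ha
  rw [← lintegral_add_left (hanti f), ← lintegral_const_mul _ (hanti h)]
  refine setLIntegral_mono (by have := hanti h; fun_prop) fun t ht => ?_
  rcases lt_or_ge t 1 with h1 | h1
  · exact volume_add_le_two_mul_of_midpoint_mem (measurableSet_lt measurable_const hf)
      (measurableSet_lt measurable_const hg) (hfs t h1) (hgs t h1)
      fun x hx y hy => H x y t ht hx hy
  · have e1 : {a | t < f a} = ∅ := by
      ext a; simpa using (hf1 a).trans h1
    have e2 : {a | t < g a} = ∅ := by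
      ext a; simpa using (hg1 a).trans h1
    simp [e1, e2]

theorem ENNReal_four_mul_le_sq_add (a b : ℝ≥0∞) : 4 * (a * b) ≤ (a + b) ^ 2 := by
  rcases eq_or_ne a ∞ with rfl | ha
  · simp
  rcases eq_or_ne b ∞ with rfl | hb
  · simp
  lift a to NNReal using ha
  lift b to NNReal using hb
  norm_cast
  rw [← NNReal.coe_le_coe]
  push_cast
  nlinarith [sq_nonneg ((a : ℝ) - b)]

/-- One-dimensional Prékopa–Leindler inequality at the midpoint, for bounded functions. -/
theorem lintegral_mul_lintegral_le_sq_of_bounded {u v h : ℝ → ℝ≥0∞} (hu : Measurable u)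
    (hv : Measurable v) (hh : Measurable h) {M : ℝ≥0∞} (hM : M ≠ ∞) (huM : ∀ x, u x ≤ M)
    (hvM : ∀ x, v x ≤ M) (H : ∀ x y, u x * v y ≤ h ((x + y) / 2) ^ 2) :
    (∫⁻ x, u x) * (∫⁻ x, v x) ≤ (∫⁻ x, h x) ^ 2 := by
  set a := ⨆ x, u x with ha
  set b := ⨆ x, v x with hb
  have haM : a ≠ ∞ := ((iSup_le huM).trans_lt hM.lt_top).ne
  have hbM : b ≠ ∞ := ((iSup_le hvM).trans_lt hM.lt_top).ne
  have hua : ∀ x, u x ≤ a := fun x => le_iSup u x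
  have hvb : ∀ x, v x ≤ b := fun x => le_iSup v x
  rcases eq_or_ne a 0 with ha0 | ha0
  · have : ∀ x, u x = 0 := fun x => le_antisymm ((hua x).trans ha0.le) zero_le
    simp [this]
  rcases eq_or_ne b 0 with hb0 | hb0
  · have : ∀ x, v x = 0 := fun x => le_antisymm ((hvb x).trans hb0.le) zero_le
    simp [this]
  set A := a.toReal with hAdef
  set B := b.toReal with hBdef
  have hA : 0 < A := ENNReal.toReal_pos ha0 haM
  have hB : 0 < B := ENNReal.toReal_pos hb0 hbM
  have hAB : 0 < √(A * B) := Real.sqrt_pos.2 (by positivity)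
  have huT : ∀ x, u x ≠ ∞ := fun x => ((hua x).trans_lt haM.lt_top).ne
  have hvT : ∀ x, v x ≠ ∞ := fun x => ((hvb x).trans_lt hbM.lt_top).ne
  let f : ℝ → ℝ := fun x => (u x).toReal / A
  let g : ℝ → ℝ := fun x => (v x).toReal / B
  -- Truncating `h` at `√(A * B)` makes it finite and loses nothing, since only heights below 1 are
  -- compared.
  let k : ℝ → ℝ := fun x => (min (h x) (ENNReal.ofReal √(A * B))).toReal / √(A * B)
  have hkT : ∀ x, min (h x) (ENNReal.ofReal √(A * B)) ≠ ∞ := fun x =>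
    ((min_le_right _ _).trans_lt ENNReal.ofReal_lt_top).ne
  have main := lintegral_ofReal_add_le_of_midpoint (f := f) (g := g) (h := k)
    (by fun_prop) (by fun_prop) (by fun_prop) (fun x => by positivity) (fun x => by positivity)
    (fun x => by positivity)
    (fun x => by
      rw [div_le_one hA]; exact ENNReal.toReal_mono haM (hua x))
    (fun x => by
      rw [div_le_one hB]; exact ENNReal.toReal_mono hbM (hvb x))
    (fun t ht => by
      have : ENNReal.ofReal (t * A) < a := by
        rw [← ENNReal.ofReal_toReal haM]
        exact (ENNReal.ofReal_lt_ofReal_iff hA).2 (by nlinarith)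
      obtain ⟨x, hx⟩ := lt_iSup_iff.1 this
      refine ⟨x, ?_⟩
      simp only [f]
      rw [lt_div_iff₀ hA]
      by_contra! hcon
      refine hx.not_ge ?_
      rw [← ENNReal.ofReal_toReal (huT x)]
      exact ENNReal.ofReal_le_ofReal hcon)
    (fun t ht => by
      have : ENNReal.ofReal (t * B) < b := by
        rw [← ENNReal.ofReal_toReal hbM]
        exact (ENNReal.ofReal_lt_ofReal_iff hB).2 (by nlinarith)
      obtain ⟨x, hx⟩ := lt_iSup_iff.1 this
      refine ⟨x, ?_⟩
      simp only [g]
      rw [lt_div_iff₀ hB]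
      by_contra! hcon
      refine hx.not_ge ?_
      rw [← ENNReal.ofReal_toReal (hvT x)]
      exact ENNReal.ofReal_le_ofReal hcon)
    (fun x y t ht hx hy => by
      simp only [f, g, k] at hx hy ⊢
      rw [lt_div_iff₀ hA] at hx
      rw [lt_div_iff₀ hB] at hy
      rw [lt_div_iff₀ hAB]
      rcases le_total (ENNReal.ofReal √(A * B)) (h ((x + y) / 2)) with hc | hc
      · rw [min_eq_right hc, ENNReal.toReal_ofReal hAB.le]
        have h1 : (u x).toReal ≤ A := ENNReal.toReal_mono haM (hua x)
        have h2 : t < 1 := by nlinarith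
        nlinarith
      · rw [min_eq_left hc]
        have hT : h ((x + y) / 2) ≠ ∞ := (hc.trans_lt ENNReal.ofReal_lt_top).ne
        have h1 := ENNReal.toReal_mono (by finiteness) (H x y)
        rw [ENNReal.toReal_mul, ENNReal.toReal_pow] at h1
        refine lt_of_pow_lt_pow_left₀ 2 ENNReal.toReal_nonneg ?_
        rw [mul_pow, Real.sq_sqrt (by positivity)]
        have h2 : t * A * (t * B) < (u x).toReal * (v y).toReal := by
          gcongr
        nlinarith)
  have eu : ∫⁻ x, u x = ENNReal.ofReal A * ∫⁻ x, ENNReal.ofReal (f x) := by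
    rw [← lintegral_const_mul _ (by fun_prop)]
    refine lintegral_congr fun x => ?_
    rw [← ENNReal.ofReal_mul hA.le, mul_div_cancel₀ _ hA.ne', ENNReal.ofReal_toReal (huT x)]
  have ev : ∫⁻ x, v x = ENNReal.ofReal B * ∫⁻ x, ENNReal.ofReal (g x) := by
    rw [← lintegral_const_mul _ (by fun_prop)]
    refine lintegral_congr fun x => ?_
    rw [← ENNReal.ofReal_mul hB.le, mul_div_cancel₀ _ hB.ne', ENNReal.ofReal_toReal (hvT x)]
  have eh : ENNReal.ofReal √(A * B) * ∫⁻ x, ENNReal.ofReal (k x) ≤ ∫⁻ x, h x := by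
    rw [← lintegral_const_mul _ (by fun_prop)]
    refine lintegral_mono fun x => ?_
    rw [← ENNReal.ofReal_mul hAB.le, mul_div_cancel₀ _ hAB.ne', ENNReal.ofReal_toReal (hkT x)]
    exact min_le_left _ _
  have hsq : ENNReal.ofReal A * ENNReal.ofReal B = ENNReal.ofReal √(A * B) ^ 2 := by
    rw [← ENNReal.ofReal_mul hA.le, ← ENNReal.ofReal_pow hAB.le, Real.sq_sqrt (by positivity)]
  set F := ∫⁻ x, ENNReal.ofReal (f x)
  set G := ∫⁻ x, ENNReal.ofReal (g x)
  set K := ∫⁻ x, ENNReal.ofReal (k x)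
  -- AM–GM turns the additive inequality for the normalised functions into the multiplicative one.
  have h4 : 4 * (F * G) ≤ 4 * K ^ 2 :=
    (ENNReal_four_mul_le_sq_add F G).trans ((pow_le_pow_left' main 2).trans_eq (by ring))
  have hFG : F * G ≤ K ^ 2 := (ENNReal.mul_le_mul_iff_right (by simp) (by simp)).1 h4
  calc (∫⁻ x, u x) * (∫⁻ x, v x) = ENNReal.ofReal A * ENNReal.ofReal B * (F * G) := by
        rw [eu, ev]; ring
    _ ≤ ENNReal.ofReal √(A * B) ^ 2 * K ^ 2 := by rw [hsq]; gcongr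
    _ = (ENNReal.ofReal √(A * B) * K) ^ 2 := by ring
    _ ≤ _ := by gcongr

/-- One-dimensional Prékopa–Leindler inequality at the midpoint. -/
theorem lintegral_mul_lintegral_le_sq {u v h : ℝ → ℝ≥0∞} (hu : Measurable u)
    (hv : Measurable v) (hh : Measurable h) (H : ∀ x y, u x * v y ≤ h ((x + y) / 2) ^ 2) :
    (∫⁻ x, u x) * (∫⁻ x, v x) ≤ (∫⁻ x, h x) ^ 2 := by
  have htrunc : ∀ w : ℝ → ℝ≥0∞, Measurable w →
      ∫⁻ x, w x = ⨆ N : ℕ, ∫⁻ x, min (w x) N := by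
    intro w hw
    have := lintegral_iSup (μ := volume) (f := fun (N : ℕ) x => min (w x) (N : ℝ≥0∞))
      (fun N => by fun_prop)
      (fun M N hMN x => min_le_min_left _ (by exact_mod_cast hMN))
    rw [← this]
    refine lintegral_congr fun x => ?_
    rw [← inf_iSup_eq (w x) (fun N : ℕ => (N : ℝ≥0∞)), ENNReal.iSup_natCast]
    simp
  rw [htrunc u hu, htrunc v hv, ENNReal.iSup_mul]
  refine iSup_le fun M => ?_
  rw [ENNReal.mul_iSup]
  refine iSup_le fun N => ?_
  refine lintegral_mul_lintegral_le_sq_of_bounded (by fun_prop) (by fun_prop) hh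
    (M := max M N) (by simp) (fun x => (min_le_right _ _).trans (le_max_left _ _))
    (fun x => (min_le_right _ _).trans (le_max_right _ _)) fun x y => le_trans ?_ (H x y)
  gcongr <;> exact min_le_left _ _

/-- Prékopa–Leindler inequality at the midpoint. -/
theorem lintegral_mul_lintegral_le_sq_pi : ∀ {n : ℕ} {u v h : (Fin n → ℝ) → ℝ≥0∞},
    Measurable u → Measurable v → Measurable h →
    (∀ x y, u x * v y ≤ h (fun i => (x i + y i) / 2) ^ 2) →
    (∫⁻ x, u x) * (∫⁻ x, v x) ≤ (∫⁻ x, h x) ^ 2 := by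
  intro n
  induction n with
  | zero =>
    intro u v h hu hv hh H
    have e : ∀ w : (Fin 0 → ℝ) → ℝ≥0∞, ∫⁻ x, w x = w 0 := by
      intro w
      rw [lintegral_unique, volume_pi]
      simp only [Measure.pi_univ, Finset.univ_eq_empty, Finset.prod_empty, mul_one]
      exact congrArg w (Subsingleton.elim _ _)
    rw [e, e, e]
    exact (H 0 0).trans_eq (by congr 2; exact Subsingleton.elim _ _)
  | succ n ih =>
    intro u v h hu hv hh H
    let e := (MeasurableEquiv.piFinSuccAbove (fun _ : Fin (n + 1) => ℝ) 0).symm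
    have he : MeasurePreserving e := (volume_preserving_piFinSuccAbove (fun _ => ℝ) 0).symm
    have hsplit : ∀ w : (Fin (n + 1) → ℝ) → ℝ≥0∞, Measurable w →
        ∫⁻ x, w x = ∫⁻ a : ℝ, ∫⁻ b : Fin n → ℝ, w (e (a, b)) := by
      intro w hw
      rw [← he.lintegral_comp hw]
      exact lintegral_prod _ (hw.comp e.measurable).aemeasurable
    have hm : ∀ w : (Fin (n + 1) → ℝ) → ℝ≥0∞, Measurable w →
        Measurable fun a : ℝ => ∫⁻ b : Fin n → ℝ, w (e (a, b)) := fun w hw =>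
      (hw.comp e.measurable).lintegral_prod_right'
    have hm' : ∀ (w : (Fin (n + 1) → ℝ) → ℝ≥0∞) (a : ℝ), Measurable w →
        Measurable fun b : Fin n → ℝ => w (e (a, b)) := fun w a hw =>
      (hw.comp e.measurable).comp (by fun_prop)
    rw [hsplit u hu, hsplit v hv, hsplit h hh]
    -- The fibre integrals satisfy the one-dimensional hypothesis by the induction hypothesis.
    refine lintegral_mul_lintegral_le_sq (hm u hu) (hm v hv) (hm h hh) fun x y => ?_
    refine ih (hm' u _ hu) (hm' v _ hv) (hm' h _ hh) fun p q => ?_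
    refine (H _ _).trans_eq ?_
    congr 2
    ext i
    refine Fin.cases ?_ (fun j => ?_) i <;>
      simp [e, MeasurableEquiv.piFinSuccAbove]

end SmallBall

/-! ### Distance to the integers, its mean square, and Gaussian integrals. -/

namespace SmallBall

/-- The distance from a real number to the nearest integer. -/
noncomputable def intDist (x : ℝ) : ℝ := |x - round x|

theorem intDist_eq_norm (x : ℝ) : intDist x = ‖(x : UnitAddCircle)‖ :=
  (UnitAddCircle.norm_eq).symm

theorem intDist_nonneg (x : ℝ) : 0 ≤ intDist x := abs_nonneg _

theorem intDist_le_half (x : ℝ) : intDist x ≤ 1 / 2 := abs_sub_round x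

theorem intDist_le_abs (x : ℝ) : intDist x ≤ |x| := by
  simpa [intDist] using round_le x 0

theorem continuous_intDist : Continuous intDist := by
  simp only [funext intDist_eq_norm]
  exact continuous_norm.comp (AddCircle.continuous_mk' 1)

theorem measurable_intDist : Measurable intDist := continuous_intDist.measurable

theorem intDist_neg (x : ℝ) : intDist (-x) = intDist x := by
  simp [intDist_eq_norm]

theorem intDist_add_sq_le (x y : ℝ) :
    intDist (x + y) ^ 2 ≤ 2 * intDist x ^ 2 + 2 * intDist y ^ 2 := by
  have h : intDist (x + y) ≤ intDist x + intDist y := by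
    simp only [intDist_eq_norm, AddCircle.coe_add]
    exact norm_add_le _ _
  nlinarith [intDist_nonneg (x + y), sq_nonneg (intDist x - intDist y)]

theorem intDist_sq_le_one (x : ℝ) : intDist x ^ 2 ≤ 1 := by
  nlinarith [intDist_nonneg x, intDist_le_half x]

theorem cos_two_pi_mul_eq (x : ℝ) :
    Real.cos (2 * Real.pi * x) = Real.cos (2 * Real.pi * intDist x) := by
  have h1 : Real.cos (2 * Real.pi * intDist x) = Real.cos (2 * Real.pi * (x - round x)) := by
    rw [intDist, ← Real.cos_abs (2 * Real.pi * (x - round x)), abs_mul,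
      abs_of_pos Real.two_pi_pos]
  rw [h1, mul_sub, mul_comm _ ((round x : ℤ) : ℝ), Real.cos_sub_int_mul_two_pi]

/-- This and `one_sub_cos_le_intDist_sq` make `intDist²` comparable to `1 - cos`, whose averages are
characteristic functions: this direction bounds characteristic functions, the other bounds Gaussian
averages of `intDist²` from below. -/
theorem eight_mul_intDist_sq_le (x : ℝ) :
    8 * intDist x ^ 2 ≤ 1 - Real.cos (2 * Real.pi * x) := by
  rw [cos_two_pi_mul_eq]
  have h := Real.cos_le_one_sub_mul_cos_sq (x := 2 * Real.pi * intDist x) (by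
    rw [abs_of_nonneg (by have := intDist_nonneg x; positivity)]
    nlinarith [intDist_le_half x, Real.pi_pos])
  have : 2 / Real.pi ^ 2 * (2 * Real.pi * intDist x) ^ 2 = 8 * intDist x ^ 2 := by
    field_simp
    ring
  linarith

theorem one_sub_cos_le_intDist_sq (x : ℝ) :
    1 - Real.cos (2 * Real.pi * x) ≤ 2 * Real.pi ^ 2 * intDist x ^ 2 := by
  rw [cos_two_pi_mul_eq]
  have := Real.one_sub_sq_div_two_le_cos (x := 2 * Real.pi * intDist x)
  nlinarith

section SqDist

variable {ι : Type*} [Fintype ι]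

/-- The mean squared distance from `x ⋆ ζ` to the integer lattice, when the coordinates of the
random vector `ζ` have laws `ν i`. -/
noncomputable def sqDist (ν : ι → Measure ℝ) (x : ι → ℝ) : ℝ := ∑ i, ∫ y, intDist (x i * y) ^ 2 ∂ν i

variable (ν : ι → Measure ℝ)

theorem sqDist_nonneg (x : ι → ℝ) : 0 ≤ sqDist ν x :=
  Finset.sum_nonneg fun _ _ => integral_nonneg fun _ => by positivity

theorem sqDist_neg (x : ι → ℝ) : sqDist ν (-x) = sqDist ν x := by
  simp [sqDist, intDist_neg]

variable [∀ i, IsProbabilityMeasure (ν i)]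

theorem integrable_intDist_sq {α : Type*} [MeasurableSpace α] (m : Measure α) [IsFiniteMeasure m]
    {f : α → ℝ} (hf : AEMeasurable f m) : Integrable (fun y => intDist (f y) ^ 2) m := by
  refine Integrable.of_bound (C := 1)
    ((measurable_intDist.comp_aemeasurable hf).pow_const 2).aestronglyMeasurable
    (ae_of_all _ fun y => ?_)
  rw [Real.norm_of_nonneg (by positivity)]
  exact intDist_sq_le_one _

theorem sqDist_add_le (x y : ι → ℝ) :
    sqDist ν (x + y) ≤ 2 * sqDist ν x + 2 * sqDist ν y := by
  simp only [sqDist, Finset.mul_sum, ← Finset.sum_add_distrib]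
  refine Finset.sum_le_sum fun i _ => ?_
  have hx := integrable_intDist_sq (ν i) (f := fun z => x i * z) (by fun_prop)
  have hy := integrable_intDist_sq (ν i) (f := fun z => y i * z) (by fun_prop)
  rw [← integral_const_mul, ← integral_const_mul,
    ← integral_add (hx.const_mul 2) (hy.const_mul 2)]
  refine integral_mono (integrable_intDist_sq _ (by fun_prop))
    ((hx.const_mul 2).add (hy.const_mul 2)) fun z => ?_
  simp only [Pi.add_apply, add_mul]
  exact intDist_add_sq_le _ _

theorem sqDist_sub_le (x y : ι → ℝ) :
    sqDist ν (x - y) ≤ 2 * sqDist ν x + 2 * sqDist ν y := by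
  simpa [sub_eq_add_neg, sqDist_neg] using sqDist_add_le ν x (-y)

theorem sqDist_le_card (x : ι → ℝ) : sqDist ν x ≤ Fintype.card ι := by
  have : ∀ i ∈ Finset.univ, ∫ y, intDist (x i * y) ^ 2 ∂ν i ≤ 1 := fun i _ => by
    have := integral_mono (integrable_intDist_sq (ν i) (f := fun z => x i * z) (by fun_prop))
      (integrable_const (1 : ℝ)) fun z => intDist_sq_le_one _
    simpa using this
  simpa [sqDist] using Finset.sum_le_sum this

theorem continuous_sqDist : Continuous (sqDist ν) := by
  refine continuous_finsetSum _ fun i _ => ?_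
  refine continuous_of_dominated (bound := fun _ => 1) (fun x => ?_) (fun x => ?_)
    (integrable_const _) (ae_of_all _ fun y => ?_)
  · exact (integrable_intDist_sq (ν i) (by fun_prop)).1
  · refine ae_of_all _ fun y => ?_
    rw [Real.norm_of_nonneg (by positivity)]
    exact intDist_sq_le_one _
  · exact (continuous_intDist.comp (by fun_prop)).pow 2

theorem sqDist_le_sum_sq (hi : ∀ i, Integrable (fun y => y ^ 2) (ν i))
    (h2 : ∀ i, ∫ y, y ^ 2 ∂ν i = 2) (x : ι → ℝ) : sqDist ν x ≤ 2 * ∑ i, x i ^ 2 := by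
  rw [sqDist, Finset.mul_sum]
  refine Finset.sum_le_sum fun i _ => ?_
  calc ∫ y, intDist (x i * y) ^ 2 ∂ν i ≤ ∫ y, x i ^ 2 * y ^ 2 ∂ν i := by
        refine integral_mono (integrable_intDist_sq _ (by fun_prop)) ((hi i).const_mul _)
          fun y => ?_
        simp only
        rw [← mul_pow, ← sq_abs (x i * y)]
        exact pow_le_pow_left₀ (intDist_nonneg _) (intDist_le_abs _) 2
    _ = 2 * x i ^ 2 := by rw [integral_const_mul, h2]; ring

end SqDist

section Gaussian

variable {κ : Type*} [Fintype κ]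

theorem integrable_exp_neg_mul_sum_sq {b : ℝ} (hb : 0 < b) :
    Integrable fun x : κ → ℝ => Real.exp (-b * ∑ i, x i ^ 2) := by
  have h := (GaussianFourier.integrable_cexp_neg_mul_sum_add (ι := κ) (b := b) (by simpa) 0).re
  refine h.congr (ae_of_all _ fun x => ?_)
  simp only [Pi.zero_apply, zero_mul, Finset.sum_const_zero, add_zero]
  have : (-(b : ℂ) * ∑ i, (x i : ℂ) ^ 2) = ((-b * ∑ i, x i ^ 2 : ℝ) : ℂ) := by push_cast; ring
  rw [this]
  exact Complex.exp_ofReal_re _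

theorem integral_exp_neg_mul_sum_sq_mul_cexp {b : ℝ} (hb : 0 < b) (a : κ → ℝ) :
    ∫ x : κ → ℝ, (Real.exp (-b * ∑ i, x i ^ 2) : ℂ) * Complex.exp ((∑ i, a i * x i : ℝ) * Complex.I)
      = ((Real.pi / b) ^ ((Fintype.card κ : ℝ) / 2) * Real.exp (-(∑ i, a i ^ 2) / (4 * b)) : ℝ) := by
  have h := GaussianFourier.integral_cexp_neg_mul_sum_add (ι := κ) (b := b) (by simpa)
    (fun i => a i * Complex.I)
  have e1 : ∀ x : κ → ℝ, (Real.exp (-b * ∑ i, x i ^ 2) : ℂ) *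
      Complex.exp ((∑ i, a i * x i : ℝ) * Complex.I) =
      Complex.exp (-b * ∑ i, (x i : ℂ) ^ 2 + ∑ i, a i * Complex.I * x i) := by
    intro x
    rw [Complex.exp_add]
    push_cast
    congr 2
    rw [Finset.sum_mul]
    exact Finset.sum_congr rfl fun i _ => by ring
  simp only [e1, h]
  push_cast
  rw [Complex.ofReal_cpow (by positivity)]
  push_cast
  congr 2
  simp only [mul_pow, Complex.I_sq, mul_neg_one, Finset.sum_neg_distrib]

theorem integral_exp_neg_mul_sum_sq {b : ℝ} (hb : 0 < b) :
    ∫ x : κ → ℝ, Real.exp (-b * ∑ i, x i ^ 2) = (Real.pi / b) ^ ((Fintype.card κ : ℝ) / 2) := by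
  have h := integral_exp_neg_mul_sum_sq_mul_cexp (κ := κ) hb 0
  simp only [Pi.zero_apply, zero_mul, Finset.sum_const_zero, Complex.ofReal_zero, Complex.exp_zero,
    mul_one, integral_complex_ofReal] at h
  have := Complex.ofReal_injective h
  simpa using this

theorem integral_exp_neg_mul_sum_sq_mul_cos {b : ℝ} (hb : 0 < b) (a : κ → ℝ) :
    ∫ x : κ → ℝ, Real.exp (-b * ∑ i, x i ^ 2) * Real.cos (∑ i, a i * x i)
      = (Real.pi / b) ^ ((Fintype.card κ : ℝ) / 2) * Real.exp (-(∑ i, a i ^ 2) / (4 * b)) := by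
  have h := congrArg Complex.re (integral_exp_neg_mul_sum_sq_mul_cexp hb a)
  rw [Complex.ofReal_re] at h
  rw [← h, ← RCLike.re_eq_complex_re, ← integral_re]
  · refine integral_congr_ae (ae_of_all _ fun x => ?_)
    simp only [RCLike.re_eq_complex_re]
    rw [Complex.re_ofReal_mul, Complex.exp_ofReal_mul_I_re]
  · refine (integrable_exp_neg_mul_sum_sq hb).ofReal.mul_bdd (c := 1)
      (Continuous.aestronglyMeasurable (by fun_prop)) (ae_of_all _ fun x => ?_)
    rw [Complex.norm_exp_ofReal_mul_I]

end Gaussian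

end SmallBall

/-! ### Gaussian averages of the mean squared distance. -/

namespace SmallBall

section Gain

variable {ι κ : Type*} [Fintype ι] [Fintype κ] (ν : ι → Measure ℝ)
  [∀ i, IsProbabilityMeasure (ν i)]

theorem sub_sq_div_two_le_one_sub_exp_neg {x : ℝ} (hx : 0 ≤ x) :
    x - x ^ 2 / 2 ≤ 1 - Real.exp (-x) := by
  rcases hx.eq_or_lt with rfl | hx
  · simp
  have h := Real.quadratic_le_exp_of_nonneg hx.le
  have h1 : Real.exp (-x) ≤ (1 + x + x ^ 2 / 2)⁻¹ := by
    rw [Real.exp_neg]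
    exact inv_anti₀ (by positivity) h
  have h2 : (1 + x + x ^ 2 / 2)⁻¹ ≤ 1 - x + x ^ 2 / 2 := by
    rw [inv_le_iff_one_le_mul₀ (by positivity)]
    -- The product of the two quadratics is `1 + x⁴/4`.
    nlinarith [pow_pos hx 4]
  linarith

theorem integrable_exp_neg_mul_sum_sq_mul_sqDist {b : ℝ} (hb : 0 < b) {g : (κ → ℝ) → ι → ℝ}
    (hg : Continuous g) :
    Integrable fun x : κ → ℝ => Real.exp (-b * ∑ i, x i ^ 2) * sqDist ν (g x) := by
  refine (integrable_exp_neg_mul_sum_sq hb).mul_bdd (c := Fintype.card ι)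
    ((continuous_sqDist ν).comp hg).aestronglyMeasurable (ae_of_all _ fun x => ?_)
  rw [Real.norm_of_nonneg (sqDist_nonneg ν _)]
  exact sqDist_le_card ν _

/-- Replacing `intDist²` by its cosine minorant makes the Gaussian average explicit, namely `1 - exp
(-X)` with `X` proportional to `y²`. Its second-order minorant leaves a main term in `y²` and an
error in `y⁴`. -/
theorem integral_gaussian_intDist_sq_ge {b : ℝ} (hb : 0 < b) (a : κ → ℝ) (y : ℝ) :
    (Real.pi / b) ^ ((Fintype.card κ : ℝ) / 2) * (1 / (2 * Real.pi ^ 2)) *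
        (Real.pi ^ 2 * (∑ i, a i ^ 2) / b * y ^ 2
          - (Real.pi ^ 2 * (∑ i, a i ^ 2) / b) ^ 2 / 2 * y ^ 4) ≤
      ∫ x : κ → ℝ, Real.exp (-b * ∑ i, x i ^ 2) * intDist ((∑ i, a i * x i) * y) ^ 2 := by
  set R := ∑ i, a i ^ 2 with hR
  have hR0 : 0 ≤ R := by positivity
  set G := (Real.pi / b) ^ ((Fintype.card κ : ℝ) / 2) with hG
  have hG0 : 0 ≤ G := by positivity
  have hcos := integral_exp_neg_mul_sum_sq_mul_cos hb (fun i => 2 * Real.pi * y * a i)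
  have hint := integrable_exp_neg_mul_sum_sq (κ := κ) hb
  have hintc : Integrable fun x : κ → ℝ => Real.exp (-b * ∑ i, x i ^ 2) *
      Real.cos (∑ i, 2 * Real.pi * y * a i * x i) :=
    hint.mul_bdd (c := 1) (Continuous.aestronglyMeasurable (by fun_prop))
      (ae_of_all _ fun x => by simpa using Real.abs_cos_le_one _)
  have e1 : ∑ i, (2 * Real.pi * y * a i) ^ 2 = 4 * Real.pi ^ 2 * y ^ 2 * R := by
    rw [hR, Finset.mul_sum]
    exact Finset.sum_congr rfl fun i _ => by ring
  rw [e1] at hcos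
  set X := Real.pi ^ 2 * R / b * y ^ 2 with hX
  have e2 : -(4 * Real.pi ^ 2 * y ^ 2 * R) / (4 * b) = -X := by
    rw [hX]; field_simp
  rw [e2] at hcos
  have hexp := sub_sq_div_two_le_one_sub_exp_neg (x := X) (by positivity)
  calc G * (1 / (2 * Real.pi ^ 2)) * (X - (Real.pi ^ 2 * R / b) ^ 2 / 2 * y ^ 4)
      = G * (1 / (2 * Real.pi ^ 2)) * (X - X ^ 2 / 2) := by rw [hX]; ring
    _ ≤ G * (1 / (2 * Real.pi ^ 2)) * (1 - Real.exp (-X)) := by gcongr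
    _ = (1 / (2 * Real.pi ^ 2)) * ∫ x : κ → ℝ, (Real.exp (-b * ∑ i, x i ^ 2) -
          Real.exp (-b * ∑ i, x i ^ 2) * Real.cos (∑ i, 2 * Real.pi * y * a i * x i)) := by
        rw [integral_sub hint hintc, hcos, integral_exp_neg_mul_sum_sq hb]
        ring
    _ = ∫ x : κ → ℝ, (1 / (2 * Real.pi ^ 2)) * (Real.exp (-b * ∑ i, x i ^ 2) -
          Real.exp (-b * ∑ i, x i ^ 2) * Real.cos (∑ i, 2 * Real.pi * y * a i * x i)) :=
        (integral_const_mul _ _).symm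
    _ ≤ _ := by
        refine integral_mono ((hint.sub hintc).const_mul _) ?_ fun x => ?_
        · refine hint.mul_bdd (c := 1) (Continuous.aestronglyMeasurable
            ((continuous_intDist.comp (by fun_prop)).pow 2)) (ae_of_all _ fun x => ?_)
          rw [Real.norm_of_nonneg (by positivity)]
          exact intDist_sq_le_one _
        · have h := one_sub_cos_le_intDist_sq ((∑ i, a i * x i) * y)
          have e3 : 2 * Real.pi * ((∑ i, a i * x i) * y) = ∑ i, 2 * Real.pi * y * a i * x i := by
            rw [Finset.sum_mul, Finset.mul_sum]
            exact Finset.sum_congr rfl fun i _ => by ring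
          rw [e3] at h
          simp only
          rw [one_div, inv_mul_le_iff₀ (by positivity), ← mul_one_sub, mul_left_comm]
          gcongr

/-- Integrating the previous bound in `y`, the second moment 2 gives the main term, and `hA` says
that the rows are short enough for the fourth-moment error to cost at most half of it. -/
theorem integral_gaussian_sqDist_ge {b M : ℝ} (hb : 0 < b)
    (hi2 : ∀ i, Integrable (fun y => y ^ 2) (ν i)) (h2 : ∀ i, ∫ y, y ^ 2 ∂ν i = 2)
    (hi4 : ∀ i, Integrable (fun y => y ^ 4) (ν i)) (h4 : ∀ i, ∫ y, y ^ 4 ∂ν i ≤ M)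
    (A : Matrix ι κ ℝ) (hA : ∀ j, Real.pi ^ 2 * (∑ i, A j i ^ 2) * M ≤ 2 * b) :
    (Real.pi / b) ^ ((Fintype.card κ : ℝ) / 2) * ((∑ j, ∑ i, A j i ^ 2) / (2 * b)) ≤
      ∫ x : κ → ℝ, Real.exp (-b * ∑ i, x i ^ 2) * sqDist ν (A.mulVec x) := by
  set G := (Real.pi / b) ^ ((Fintype.card κ : ℝ) / 2) with hG
  have hG0 : 0 ≤ G := by positivity
  have hint := integrable_exp_neg_mul_sum_sq (κ := κ) hb
  have hprod : ∀ j, Integrable (fun p : (κ → ℝ) × ℝ => Real.exp (-b * ∑ i, p.1 i ^ 2) *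
      intDist (A.mulVec p.1 j * p.2) ^ 2) (volume.prod (ν j)) := by
    intro j
    refine (hint.comp_fst (ν j)).mul_bdd (c := 1) (Continuous.aestronglyMeasurable
      ((continuous_intDist.comp ?_).pow 2)) (ae_of_all _ fun x => ?_)
    · simp only [Matrix.mulVec, dotProduct]
      fun_prop
    · rw [Real.norm_of_nonneg (by positivity)]
      exact intDist_sq_le_one _
  have e1 : ∫ x : κ → ℝ, Real.exp (-b * ∑ i, x i ^ 2) * sqDist ν (A.mulVec x) =
      ∑ j, ∫ y, (∫ x : κ → ℝ, Real.exp (-b * ∑ i, x i ^ 2) *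
        intDist (A.mulVec x j * y) ^ 2) ∂ν j := by
    have : ∀ x : κ → ℝ, Real.exp (-b * ∑ i, x i ^ 2) * sqDist ν (A.mulVec x) =
        ∑ j, ∫ y, Real.exp (-b * ∑ i, x i ^ 2) * intDist (A.mulVec x j * y) ^ 2 ∂ν j := by
      intro x
      rw [sqDist, Finset.mul_sum]
      simp only [integral_const_mul]
    simp only [this]
    rw [integral_finsetSum]
    · exact Finset.sum_congr rfl fun j _ => integral_integral_swap (hprod j)
    · exact fun j _ => (hprod j).integral_prod_left
  rw [e1, Finset.sum_div, Finset.mul_sum]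
  refine Finset.sum_le_sum fun j _ => ?_
  set R := ∑ i, A j i ^ 2 with hR
  have hR0 : 0 ≤ R := by positivity
  have step : ∫ y, G * (1 / (2 * Real.pi ^ 2)) * (Real.pi ^ 2 * R / b * y ^ 2
      - (Real.pi ^ 2 * R / b) ^ 2 / 2 * y ^ 4) ∂ν j ≤ ∫ y, (∫ x : κ → ℝ,
        Real.exp (-b * ∑ i, x i ^ 2) * intDist (A.mulVec x j * y) ^ 2) ∂ν j :=
    integral_mono ((((hi2 j).const_mul _).sub ((hi4 j).const_mul _)).const_mul _)
      (hprod j).integral_prod_right fun y => integral_gaussian_intDist_sq_ge hb (A j) y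
  refine le_trans ?_ step
  rw [integral_const_mul, integral_sub ((hi2 j).const_mul _) ((hi4 j).const_mul _),
    integral_const_mul, integral_const_mul, h2, mul_assoc]
  refine mul_le_mul_of_nonneg_left ?_ hG0
  have h5 : (Real.pi ^ 2 * R / b) ^ 2 / 2 * ∫ y, y ^ 4 ∂ν j ≤ Real.pi ^ 2 * R / b := by
    calc _ ≤ (Real.pi ^ 2 * R / b) ^ 2 / 2 * M := by gcongr; exact h4 j
      _ = (Real.pi ^ 2 * R / b) * ((Real.pi ^ 2 * R * M) / (2 * b)) := by field_simp
      _ ≤ (Real.pi ^ 2 * R / b) * 1 := by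
        gcongr
        rw [div_le_one (by positivity)]
        exact hA j
      _ = _ := mul_one _
  calc R / (2 * b) = 1 / (2 * Real.pi ^ 2) * (Real.pi ^ 2 * R / b) := by
        field_simp
    _ ≤ _ := by
        gcongr
        linarith

/-- Averaged lower bound for the shifted mean squared distance. -/
theorem integral_gaussian_sqDist_add_ge {b M : ℝ} (hb : 0 < b)
    (hi2 : ∀ i, Integrable (fun y => y ^ 2) (ν i)) (h2 : ∀ i, ∫ y, y ^ 2 ∂ν i = 2)
    (hi4 : ∀ i, Integrable (fun y => y ^ 4) (ν i)) (h4 : ∀ i, ∫ y, y ^ 4 ∂ν i ≤ M)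
    (A : Matrix ι κ ℝ) (hA : ∀ j, 2 * Real.pi ^ 2 * (∑ i, A j i ^ 2) * M ≤ b) (v : ι → ℝ) :
    (Real.pi / b) ^ ((Fintype.card κ : ℝ) / 2) * ((∑ j, ∑ i, A j i ^ 2) / (2 * b)) ≤
      ∫ x : κ → ℝ, Real.exp (-b * ∑ i, x i ^ 2) * sqDist ν (A.mulVec x + v) := by
  have hc : Continuous fun x : κ → ℝ => A.mulVec x := continuous_const.matrix_mulVec continuous_id
  -- The shift disappears from `2Ax = (Ax + v) - (-Ax + v)`, and `x`, `-x` have the same Gaussian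
  -- weight. The resulting factor 4 cancels against the squared Hilbert–Schmidt norm of `2A`.
  have h := integral_gaussian_sqDist_ge ν hb hi2 h2 hi4 h4 ((2 : ℝ) • A) (fun j => by
    have : ∑ i, ((2 : ℝ) • A) j i ^ 2 = 4 * ∑ i, A j i ^ 2 := by
      rw [Finset.mul_sum]
      exact Finset.sum_congr rfl fun i _ => by rw [Matrix.smul_apply, smul_eq_mul]; ring
    rw [this]
    linarith [hA j])
  have e : ∑ j, ∑ i, ((2 : ℝ) • A) j i ^ 2 = 4 * ∑ j, ∑ i, A j i ^ 2 := by
    simp only [Finset.mul_sum]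
    exact Finset.sum_congr rfl fun j _ => Finset.sum_congr rfl fun i _ => by
      rw [Matrix.smul_apply, smul_eq_mul]; ring
  rw [e] at h
  have hI := integrable_exp_neg_mul_sum_sq_mul_sqDist ν hb
    (g := fun x : κ → ℝ => A.mulVec x + v) (by fun_prop)
  have hI' := integrable_exp_neg_mul_sum_sq_mul_sqDist ν hb
    (g := fun x : κ → ℝ => A.mulVec (-x) + v) (by fun_prop)
  have hneg : ∫ x : κ → ℝ, Real.exp (-b * ∑ i, x i ^ 2) * sqDist ν (A.mulVec (-x) + v) =
      ∫ x : κ → ℝ, Real.exp (-b * ∑ i, x i ^ 2) * sqDist ν (A.mulVec x + v) := by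
    rw [← integral_neg_eq_self (fun x : κ → ℝ =>
      Real.exp (-b * ∑ i, x i ^ 2) * sqDist ν (A.mulVec x + v))]
    simp
  have hle : ∫ x : κ → ℝ, Real.exp (-b * ∑ i, x i ^ 2) * sqDist ν (((2 : ℝ) • A).mulVec x) ≤
      4 * ∫ x : κ → ℝ, Real.exp (-b * ∑ i, x i ^ 2) * sqDist ν (A.mulVec x + v) := by
    calc _ ≤ ∫ x : κ → ℝ, (2 * (Real.exp (-b * ∑ i, x i ^ 2) * sqDist ν (A.mulVec x + v)) +
          2 * (Real.exp (-b * ∑ i, x i ^ 2) * sqDist ν (A.mulVec (-x) + v))) := by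
          refine integral_mono (integrable_exp_neg_mul_sum_sq_mul_sqDist ν hb
            (continuous_const.matrix_mulVec continuous_id))
            ((hI.const_mul 2).add (hI'.const_mul 2)) fun x => ?_
          have h1 := sqDist_sub_le ν (A.mulVec x + v) (A.mulVec (-x) + v)
          have h3 : A.mulVec x + v - (A.mulVec (-x) + v) = ((2 : ℝ) • A).mulVec x := by
            rw [Matrix.mulVec_neg, Matrix.smul_mulVec, two_smul]; abel
          rw [h3] at h1
          have := mul_le_mul_of_nonneg_left h1 (Real.exp_pos (-b * ∑ i, x i ^ 2)).le
          linarith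
      _ = _ := by
          rw [integral_add (hI.const_mul 2) (hI'.const_mul 2), integral_const_mul,
            integral_const_mul, hneg]
          ring
  have := h.trans hle
  rw [mul_div_assoc, mul_left_comm] at this
  linarith

end Gain

end SmallBall

/-! ### Exponential gain in the number of columns; domination by Cauchy densities. -/

namespace SmallBall

/-- Exponential decay in the number of columns of `A`, uniformly in the shift `v`. -/
theorem lintegral_gaussian_exp_neg_sqDist_le {ι : Type*} [Fintype ι] {k : ℕ}
    (ν : ι → Measure ℝ) [∀ i, IsProbabilityMeasure (ν i)] {b q M r : ℝ} (hb : 0 < b) (hq : 0 ≤ q)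
    (hi2 : ∀ i, Integrable (fun y => y ^ 2) (ν i)) (h2 : ∀ i, ∫ y, y ^ 2 ∂ν i = 2)
    (hi4 : ∀ i, Integrable (fun y => y ^ 4) (ν i)) (h4 : ∀ i, ∫ y, y ^ 4 ∂ν i ≤ M)
    (A : Matrix ι (Fin k) ℝ) (hA : ∀ j, 2 * Real.pi ^ 2 * (∑ i, A j i ^ 2) * M ≤ b)
    (hAr : ∀ z, ∑ j, A.mulVec z j ^ 2 ≤ r * ∑ i, z i ^ 2) (hr : 4 * q * r ≤ b) (v : ι → ℝ) :
    ∫⁻ x : Fin k → ℝ, ENNReal.ofReal (Real.exp (-b * ∑ i, x i ^ 2) *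
        Real.exp (-q * sqDist ν (A.mulVec x + v))) ≤
      ENNReal.ofReal ((Real.pi / b) ^ ((k : ℝ) / 2) *
        Real.exp (-(q / 2) * ((∑ j, ∑ i, A j i ^ 2) / (2 * b)))) := by
  set G := (Real.pi / b) ^ ((k : ℝ) / 2) with hG
  have hG0 : 0 < G := by have := Real.pi_pos; positivity
  set a := (∑ j, ∑ i, A j i ^ 2) / (2 * b) with ha
  have hc : Continuous fun x : Fin k → ℝ => A.mulVec x + v :=
    (continuous_const.matrix_mulVec continuous_id).add continuous_const
  have hcD : Continuous fun x : Fin k → ℝ => sqDist ν (A.mulVec x + v) :=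
    (continuous_sqDist ν).comp hc
  have hint := integrable_exp_neg_mul_sum_sq (κ := Fin k) hb
  have hGi := integral_exp_neg_mul_sum_sq (κ := Fin k) hb
  rw [Fintype.card_fin, ← hG] at hGi
  set V := ∫⁻ x : Fin k → ℝ, ENNReal.ofReal (Real.exp (-b * ∑ i, x i ^ 2) *
        Real.exp (-q * sqDist ν (A.mulVec x + v))) with hV
  set U := ∫⁻ x : Fin k → ℝ, ENNReal.ofReal (Real.exp (-b * ∑ i, x i ^ 2) *
        Real.exp (q / 2 * sqDist ν (A.mulVec x + v))) with hU
  -- The exponent `(q/2) D(x) - q D(y)` is at most `q D(A(x - y)) ≤ 2qr|x - y|²`. The parallelogram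
  -- identity for the Gaussian releases `b|x - y|²/2`, which absorbs it exactly when `4qr ≤ b`.
  have hPL : U * V ≤ (∫⁻ x : Fin k → ℝ, ENNReal.ofReal (Real.exp (-b * ∑ i, x i ^ 2))) ^ 2 := by
    refine lintegral_mul_lintegral_le_sq_pi (ENNReal.continuous_ofReal.comp (by fun_prop)).measurable
      (ENNReal.continuous_ofReal.comp (by fun_prop)).measurable
      (ENNReal.continuous_ofReal.comp (by fun_prop)).measurable fun x y => ?_
    rw [← ENNReal.ofReal_mul (by positivity), ← ENNReal.ofReal_pow (by positivity)]
    refine ENNReal.ofReal_le_ofReal ?_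
    rw [← Real.exp_add, ← Real.exp_add, ← Real.exp_add, sq, ← Real.exp_add]
    refine Real.exp_le_exp.2 ?_
    have h1 := sqDist_add_le ν (A.mulVec y + v) (A.mulVec (x - y))
    have e1 : A.mulVec y + v + A.mulVec (x - y) = A.mulVec x + v := by
      rw [Matrix.mulVec_sub]; abel
    rw [e1] at h1
    have h3 := (sqDist_le_sum_sq ν hi2 h2 (A.mulVec (x - y))).trans
      (mul_le_mul_of_nonneg_left (hAr (x - y)) zero_le_two)
    have e2 : ∑ i, (x i ^ 2) + ∑ i, y i ^ 2 - 2 * ∑ i, ((x i + y i) / 2) ^ 2 =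
        (∑ i, (x - y) i ^ 2) / 2 := by
      rw [Finset.mul_sum, ← Finset.sum_add_distrib, ← Finset.sum_sub_distrib, Finset.sum_div]
      exact Finset.sum_congr rfl fun i _ => by simp only [Pi.sub_apply]; ring
    have h5 : 0 ≤ ∑ i, (x - y) i ^ 2 := by positivity
    have h6 := mul_le_mul_of_nonneg_right hr h5
    have h7 : q / 2 * sqDist ν (A.mulVec x + v) ≤
        q / 2 * (2 * sqDist ν (A.mulVec y + v) + 2 * (2 * (r * ∑ i, (x - y) i ^ 2))) := by
      refine mul_le_mul_of_nonneg_left ?_ (by positivity)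
      linarith
    have h8 := congrArg (b * ·) e2
    linarith
  have hGl : ∫⁻ x : Fin k → ℝ, ENNReal.ofReal (Real.exp (-b * ∑ i, x i ^ 2)) =
      ENNReal.ofReal G := by
    rw [← ofReal_integral_eq_lintegral_ofReal hint (ae_of_all _ fun x => by positivity), hGi]
  have hI := integrable_exp_neg_mul_sum_sq_mul_sqDist ν hb hc
  have havg := integral_gaussian_sqDist_add_ge ν hb hi2 h2 hi4 h4 A hA v
  rw [Fintype.card_fin, ← hG, ← ha] at havg
  have hUge : ENNReal.ofReal (G * Real.exp (q / 2 * a)) ≤ U := by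
    have hbd : Integrable fun x : Fin k → ℝ => Real.exp (-b * ∑ i, x i ^ 2) *
        Real.exp (q / 2 * sqDist ν (A.mulVec x + v)) := by
      refine hint.mul_bdd (c := Real.exp (q / 2 * Fintype.card ι))
        (Continuous.aestronglyMeasurable (by fun_prop)) (ae_of_all _ fun x => ?_)
      rw [Real.norm_of_nonneg (by positivity)]
      have := sqDist_le_card ν (A.mulVec x + v)
      gcongr
    rw [hU, ← ofReal_integral_eq_lintegral_ofReal hbd (ae_of_all _ fun x => by positivity)]
    refine ENNReal.ofReal_le_ofReal ?_
    -- Jensen's inequality, in the form of the tangent line to `exp` at `q/2 * a`.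
    have hJ : ∫ x : Fin k → ℝ, (Real.exp (q / 2 * a) * (1 - q / 2 * a) *
          Real.exp (-b * ∑ i, x i ^ 2) + Real.exp (q / 2 * a) * (q / 2) *
          (Real.exp (-b * ∑ i, x i ^ 2) * sqDist ν (A.mulVec x + v))) ≤
        ∫ x : Fin k → ℝ, Real.exp (-b * ∑ i, x i ^ 2) *
          Real.exp (q / 2 * sqDist ν (A.mulVec x + v)) := by
      refine integral_mono ((hint.const_mul _).add (hI.const_mul _)) hbd fun x => ?_
      have h1 := Real.add_one_le_exp (q / 2 * sqDist ν (A.mulVec x + v) - q / 2 * a)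
      rw [Real.exp_sub, le_div_iff₀ (Real.exp_pos _)] at h1
      have h3 := mul_le_mul_of_nonneg_left h1 (Real.exp_pos (-b * ∑ i, x i ^ 2)).le
      simp only
      linarith
    refine le_trans ?_ hJ
    rw [integral_add (hint.const_mul _) (hI.const_mul _), integral_const_mul, integral_const_mul,
      hGi]
    have := mul_le_mul_of_nonneg_left havg
      (by positivity : 0 ≤ Real.exp (q / 2 * a) * (q / 2))
    linarith
  rw [hGl] at hPL
  have hfin : ENNReal.ofReal (G * Real.exp (q / 2 * a)) * V ≤
      ENNReal.ofReal (G * Real.exp (q / 2 * a)) *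
        ENNReal.ofReal (G * Real.exp (-(q / 2) * a)) := by
    refine (mul_le_mul_left hUge V).trans (hPL.trans_eq ?_)
    rw [← ENNReal.ofReal_mul (by positivity), ← ENNReal.ofReal_pow hG0.le]
    congr 1
    rw [neg_mul, Real.exp_neg]
    field_simp
  exact (ENNReal.mul_le_mul_iff_right (by simpa using by positivity) (by simp)).1 hfin

theorem integral_prod_cauchy {κ : Type*} [Fintype κ] {a : κ → ℝ} (ha : ∀ i, 0 < a i) :
    Integrable (fun z : κ → ℝ => ∏ i, (2 * (1 + (a i * z i) ^ 2)⁻¹)) ∧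
      ∫ z : κ → ℝ, ∏ i, (2 * (1 + (a i * z i) ^ 2)⁻¹) = ∏ i, (2 * Real.pi / a i) := by
  constructor
  · refine Integrable.fintype_prod (f := fun i (x : ℝ) => 2 * (1 + (a i * x) ^ 2)⁻¹) fun i => ?_
    exact (integrable_inv_one_add_sq.comp_mul_left' (ha i).ne').const_mul 2
  · rw [integral_fintype_prod_volume_eq_prod (fun i (x : ℝ) => 2 * (1 + (a i * x) ^ 2)⁻¹)]
    refine Finset.prod_congr rfl fun i _ => ?_
    rw [integral_const_mul, Measure.integral_comp_mul_left (fun x : ℝ => (1 + x ^ 2)⁻¹) (a i),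
      integral_univ_inv_one_add_sq, abs_of_pos (inv_pos.2 (ha i)), smul_eq_mul]
    ring

/-- A radial logarithmic bound becomes a product, which can be integrated coordinatewise: AM–GM
gives `∏ (1 + wᵢ²) ≤ (1 + S)^m`, and `1 + S ≤ 2 max(1, √S)²` accounts for the factors 2. -/
theorem exp_neg_posLog_le_prod {m : ℕ} (hm : 0 < m) (w : Fin m → ℝ) {p : ℝ} (hp : 2 * m ≤ p) :
    Real.exp (-p * Real.posLog √((∑ i, w i ^ 2) / m)) ≤ ∏ i, (2 * (1 + w i ^ 2)⁻¹) := by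
  set S := (∑ i, w i ^ 2) / m with hS
  have hS0 : 0 ≤ S := by positivity
  have hm' : (0 : ℝ) < m := by exact_mod_cast hm
  have h1 : ∏ i, (1 + w i ^ 2) ≤ (1 + S) ^ m := by
    have hS1 : 0 < 1 + S := by positivity
    calc ∏ i, (1 + w i ^ 2)
        -- AM–GM through `t ≤ exp (t - 1)`: the exponents sum to zero because `S` is the mean of the
        -- `wᵢ²`.
        ≤ ∏ i, ((1 + S) * Real.exp ((1 + w i ^ 2) / (1 + S) - 1)) := by
          refine Finset.prod_le_prod (fun i _ => by positivity) fun i _ => ?_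
          have := Real.add_one_le_exp ((1 + w i ^ 2) / (1 + S) - 1)
          rw [sub_add_cancel, div_le_iff₀ hS1] at this
          linarith
      _ = (1 + S) ^ m := by
          rw [Finset.prod_mul_distrib, ← Real.exp_sum, Finset.sum_sub_distrib, ← Finset.sum_div,
            Finset.sum_add_distrib]
          have : ∑ i, w i ^ 2 = S * m := by rw [hS]; field_simp
          rw [this]
          simp only [Finset.sum_const, Finset.card_univ, Fintype.card_fin, Finset.prod_const,
            nsmul_eq_mul, mul_one]
          have : (m + S * m) / (1 + S) - (m : ℝ) = 0 := by field_simp; ring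
          rw [this, Real.exp_zero, mul_one]
  have h2 : (1 + S) ≤ 2 * max 1 √S ^ 2 := by
    rcases le_total 1 √S with h | h
    · rw [max_eq_right h, Real.sq_sqrt hS0]
      have := Real.one_le_sqrt.1 h
      linarith
    · rw [max_eq_left h]
      have := Real.sqrt_le_one.1 h
      linarith
  have h3 : Real.exp (-p * Real.posLog √S) ≤ (max 1 √S ^ 2)⁻¹ ^ m := by
    have : max 1 √S = Real.exp (Real.posLog √S) := by
      rw [Real.posLog_eq_log_max_one (Real.sqrt_nonneg _), Real.exp_log (by positivity)]
    rw [this, ← Real.exp_nat_mul, ← Real.exp_neg, ← Real.exp_nat_mul]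
    refine Real.exp_le_exp.2 ?_
    have := mul_le_mul_of_nonneg_right hp (Real.posLog_nonneg (x := √S))
    push_cast
    linarith
  refine h3.trans ?_
  rw [Finset.prod_mul_distrib, Finset.prod_inv_distrib, Finset.prod_const, Finset.card_univ,
    Fintype.card_fin, inv_pow, ← div_eq_mul_inv, le_div_iff₀ (by positivity),
    inv_mul_le_iff₀ (by positivity)]
  calc ∏ i, (1 + w i ^ 2) ≤ (1 + S) ^ m := h1
    _ ≤ (2 * max 1 √S ^ 2) ^ m := by gcongr
    _ = _ := by rw [mul_pow]; ring

end SmallBall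

/-! ### Reduction to unit cubes, and decoupling. -/

namespace SmallBall

/-- Gaussian integrals are controlled by integrals over unit cubes. -/
theorem lintegral_gaussian_mul_le_of_cube {κ : Type*} [Fintype κ] {F : (κ → ℝ) → ℝ≥0∞}
    (hF : Measurable F) {K : ℝ≥0∞} (hK : ∀ c : κ → ℝ, ∫⁻ x in Set.Icc c (c + 1), F x ≤ K) :
    ∫⁻ x : κ → ℝ, ENNReal.ofReal (Real.exp (-Real.pi * ∑ i, x i ^ 2)) * F x ≤
      ENNReal.ofReal (Real.exp (Real.pi * Fintype.card κ) * 2 ^ ((Fintype.card κ : ℝ) / 2)) * K := by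
  have hπ := Real.pi_pos
  let g : (κ → ℝ) → ℝ≥0∞ := fun c =>
    ENNReal.ofReal (Real.exp (Real.pi * Fintype.card κ) * Real.exp (-(Real.pi / 2) * ∑ i, c i ^ 2))
  have hg : Measurable g := (ENNReal.continuous_ofReal.comp (by fun_prop)).measurable
  have hmeas : MeasurableSet {p : (κ → ℝ) × (κ → ℝ) | p.1 ∈ Set.Icc p.2 (p.2 + 1)} := by
    have : IsClosed {p : (κ → ℝ) × (κ → ℝ) | p.1 ∈ Set.Icc p.2 (p.2 + 1)} :=
      (isClosed_le continuous_snd continuous_fst).inter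
        (isClosed_le continuous_fst (continuous_snd.add continuous_const))
    exact this.measurableSet
  have hpt : ∀ x : κ → ℝ, ENNReal.ofReal (Real.exp (-Real.pi * ∑ i, x i ^ 2)) ≤
      ∫⁻ c, {p : (κ → ℝ) × (κ → ℝ) | p.1 ∈ Set.Icc p.2 (p.2 + 1)}.indicator
        (fun p => g p.2) (x, c) := by
    -- The corners `c` of the unit cubes containing `x` fill a set of volume 1, and there `|c|² ≤
    -- 2|x|² + 2 card κ`, so `g c` dominates the weight at `x`. Tonelli then integrates over `x`
    -- first.
    intro x
    have h1 : (volume : Measure (κ → ℝ)) (Set.Icc (x - 1) x) = 1 := by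
      rw [Real.volume_Icc_pi]
      simp
    calc ENNReal.ofReal (Real.exp (-Real.pi * ∑ i, x i ^ 2))
        = ∫⁻ c in Set.Icc (x - 1) x, ENNReal.ofReal (Real.exp (-Real.pi * ∑ i, x i ^ 2)) := by
          rw [setLIntegral_const, h1, mul_one]
      _ ≤ ∫⁻ c in Set.Icc (x - 1) x, g c := by
          refine setLIntegral_mono hg fun c hc => ENNReal.ofReal_le_ofReal ?_
          rw [← Real.exp_add]
          refine Real.exp_le_exp.2 ?_
          have h2 : ∑ i, c i ^ 2 ≤ 2 * ∑ i, x i ^ 2 + 2 * Fintype.card κ := by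
            have : ∀ i ∈ Finset.univ, c i ^ 2 ≤ 2 * x i ^ 2 + 2 := fun i _ => by
              have h3 := hc.1 i
              have h4 := hc.2 i
              simp only [Pi.sub_apply, Pi.one_apply] at h3
              nlinarith [sq_nonneg (c i - 2 * x i)]
            refine (Finset.sum_le_sum this).trans_eq ?_
            rw [Finset.sum_add_distrib, ← Finset.mul_sum]
            simp [mul_comm]
          nlinarith
      _ = ∫⁻ c, (Set.Icc (x - 1) x).indicator g c := (lintegral_indicator measurableSet_Icc _).symm
      _ = _ := by
          refine lintegral_congr fun c => ?_
          have : c ∈ Set.Icc (x - 1) x ↔ x ∈ Set.Icc c (c + 1) := by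
            rw [Set.mem_Icc, Set.mem_Icc, sub_le_iff_le_add, and_comm]
          by_cases hx : x ∈ Set.Icc c (c + 1)
          · rw [Set.indicator_of_mem (this.2 hx), Set.indicator_of_mem (by exact hx)]
          · rw [Set.indicator_of_notMem (mt this.1 hx), Set.indicator_of_notMem (by exact hx)]
  calc ∫⁻ x : κ → ℝ, ENNReal.ofReal (Real.exp (-Real.pi * ∑ i, x i ^ 2)) * F x
      ≤ ∫⁻ x : κ → ℝ, ∫⁻ c, {p : (κ → ℝ) × (κ → ℝ) | p.1 ∈ Set.Icc p.2 (p.2 + 1)}.indicator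
        (fun p => g p.2) (x, c) * F x := by
        refine lintegral_mono fun x => ?_
        rw [lintegral_mul_const]
        · exact mul_le_mul_left (hpt x) _
        · exact ((hg.comp measurable_snd).indicator hmeas).comp (by fun_prop)
    _ = ∫⁻ c, ∫⁻ x : κ → ℝ, {p : (κ → ℝ) × (κ → ℝ) | p.1 ∈ Set.Icc p.2 (p.2 + 1)}.indicator
        (fun p => g p.2) (x, c) * F x := by
        refine lintegral_lintegral_swap (Measurable.aemeasurable ?_)
        exact ((hg.comp measurable_snd).indicator hmeas).mul (hF.comp measurable_fst)
    _ = ∫⁻ c, g c * ∫⁻ x in Set.Icc c (c + 1), F x := by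
        refine lintegral_congr fun c => ?_
        rw [← lintegral_indicator measurableSet_Icc, ← lintegral_const_mul _
          (hF.indicator measurableSet_Icc)]
        refine lintegral_congr fun x => ?_
        by_cases hx : x ∈ Set.Icc c (c + 1)
        · simp only [Set.indicator, Set.mem_ofPred_eq, hx, if_true]
        · simp only [Set.indicator, Set.mem_ofPred_eq, hx, if_false, zero_mul, mul_zero]
    _ ≤ ∫⁻ c, g c * K := lintegral_mono fun c => mul_le_mul_right (hK c) _
    _ = _ := by
        rw [lintegral_mul_const _ hg, ← ofReal_integral_eq_lintegral_ofReal
          ((integrable_exp_neg_mul_sum_sq (by positivity)).const_mul _)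
          (ae_of_all _ fun x => by positivity), integral_const_mul,
          integral_exp_neg_mul_sum_sq (by positivity)]
        congr 4
        field_simp

/-- Decoupling: after completing with a near-minimiser, the `θ`-integral and the Gaussian
integral separate. -/
theorem exists_lintegral_decouple_le {ι κ : Type*} [Fintype ι] [Fintype κ] {k : ℕ}
    (ν : ι → Measure ℝ) [∀ i, IsProbabilityMeasure (ν i)] {p M r : ℝ} (hp : 0 ≤ p) (hr0 : 0 ≤ r)
    (hpr : 8 * p * r ≤ 1)
    (hi2 : ∀ i, Integrable (fun y => y ^ 2) (ν i)) (h2 : ∀ i, ∫ y, y ^ 2 ∂ν i = 2)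
    (hi4 : ∀ i, Integrable (fun y => y ^ 4) (ν i)) (h4 : ∀ i, ∫ y, y ^ 4 ∂ν i ≤ M)
    (A : Matrix ι (Fin k) ℝ) (hA : ∀ j, 2 * Real.pi ^ 2 * (∑ i, A j i ^ 2) * M ≤ 1)
    (hAr : ∀ z, ∑ j, A.mulVec z j ^ 2 ≤ r * ∑ i, z i ^ 2) (B : Matrix ι κ ℝ)
    {Q : Set (κ → ℝ)} (hQ : Q.Nonempty) :
    ∃ θ₀ ∈ Q, ∫⁻ θ in Q, ∫⁻ x : Fin k → ℝ, ENNReal.ofReal (Real.exp (-Real.pi * ∑ i, x i ^ 2) *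
        Real.exp (-p * sqDist ν (A.mulVec x + B.mulVec θ))) ≤
      ENNReal.ofReal (Real.exp (1 / 2) * Real.exp (p * r / 128 / Real.pi * k -
        255 / 1024 / Real.pi * p * (∑ j, ∑ i, A j i ^ 2))) *
      ∫⁻ θ in Q, ENNReal.ofReal (Real.exp (-(p / 2048) * sqDist ν (B.mulVec (θ - θ₀)))) := by
  have hπ := Real.pi_gt_three
  set ε := p * r / 128 with hε
  have hε0 : 0 ≤ ε := by positivity
  have hε1 : ε ≤ 1 / 1024 := by rw [hε]; linarith
  let h : (Fin k → ℝ) × Q → ℝ := fun y =>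
    p / 256 * sqDist ν (A.mulVec y.1 + B.mulVec y.2) + ε * ∑ i, y.1 i ^ 2
  have hbdd : BddBelow (Set.range h) := ⟨0, by
    rintro _ ⟨y, rfl⟩
    have := sqDist_nonneg ν (A.mulVec y.1 + B.mulVec y.2)
    simp only [h]
    positivity⟩
  have : Nonempty Q := hQ.to_subtype
  -- A minimiser up to 1 suffices; the slack reappears as the factor `exp (1/2)`.
  obtain ⟨⟨x₀, θ₀, hθ₀⟩, hmin⟩ := exists_lt_of_ciInf_lt (lt_add_one (⨅ y, h y))
  have hmin' : ∀ x θ, θ ∈ Q → p / 256 * sqDist ν (A.mulVec x₀ + B.mulVec θ₀) +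
      ε * ∑ i, x₀ i ^ 2 ≤ p / 256 * sqDist ν (A.mulVec x + B.mulVec θ) + ε * ∑ i, x i ^ 2 + 1 := by
    intro x θ hθ
    have := ciInf_le hbdd ⟨x, θ, hθ⟩
    simp only [h] at this hmin
    linarith
  refine ⟨θ₀, hθ₀, ?_⟩
  -- Two quasi-triangle inequalities bound the left term by half of `h(x, θ) + h(x₀, θ₀)`, hence by
  -- `h(x, θ) + 1/2`. The value `ε = pr/128` is what matches the `|x|²` terms here.
  have hlow : ∀ x θ, θ ∈ Q → p / 2048 * sqDist ν (B.mulVec (θ - θ₀)) - 1 / 2 ≤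
      p / 256 * sqDist ν (A.mulVec x + B.mulVec θ) + ε * ∑ i, x i ^ 2 := by
    intro x θ hθ
    have h1 := hmin' x θ hθ
    have h3 := sqDist_sub_le ν (A.mulVec x + B.mulVec θ) (A.mulVec x₀ + B.mulVec θ₀)
    have h5 := sqDist_sub_le ν (A.mulVec x + B.mulVec θ - (A.mulVec x₀ + B.mulVec θ₀))
      (A.mulVec (x - x₀))
    have e : A.mulVec x + B.mulVec θ - (A.mulVec x₀ + B.mulVec θ₀) - A.mulVec (x - x₀) =
        B.mulVec (θ - θ₀) := by
      rw [Matrix.mulVec_sub, Matrix.mulVec_sub]; abel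
    rw [e] at h5
    have h6 := (sqDist_le_sum_sq ν hi2 h2 (A.mulVec (x - x₀))).trans
      (mul_le_mul_of_nonneg_left (hAr (x - x₀)) zero_le_two)
    have h7 : ∑ i, (x - x₀) i ^ 2 ≤ 2 * ∑ i, x i ^ 2 + 2 * ∑ i, x₀ i ^ 2 := by
      rw [Finset.mul_sum, Finset.mul_sum, ← Finset.sum_add_distrib]
      refine Finset.sum_le_sum fun i _ => ?_
      simp only [Pi.sub_apply]
      nlinarith [sq_nonneg (x i + x₀ i)]
    have h8 : sqDist ν (B.mulVec (θ - θ₀)) ≤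
        4 * sqDist ν (A.mulVec x + B.mulVec θ) + 4 * sqDist ν (A.mulVec x₀ + B.mulVec θ₀) +
          8 * r * (∑ i, x i ^ 2 + ∑ i, x₀ i ^ 2) := by
      have := mul_le_mul_of_nonneg_left h7 hr0
      linarith
    have h9 := mul_le_mul_of_nonneg_left h8 (by positivity : 0 ≤ p / 2048)
    have e2 : p / 2048 * (8 * r * (∑ i, x i ^ 2 + ∑ i, x₀ i ^ 2)) =
        ε * (∑ i, x i ^ 2 + ∑ i, x₀ i ^ 2) / 2 := by rw [hε]; ring
    linarith
  -- What is left after paying for `h`: Gaussian weight `π - ε` and exponent `p - p/256`.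
  set b := Real.pi - ε with hb
  have hb0 : 0 < b := by rw [hb]; linarith
  have hgain := lintegral_gaussian_exp_neg_sqDist_le ν hb0 (q := 255 / 256 * p) (by positivity)
    hi2 h2 hi4 h4 A (fun j => (hA j).trans (by linarith)) hAr (by nlinarith)
  set S := ∑ j, ∑ i, A j i ^ 2 with hS
  have hS0 : 0 ≤ S := by positivity
  have hG : (Real.pi / b) ^ ((k : ℝ) / 2) * Real.exp (-(255 / 256 * p / 2) * (S / (2 * b))) ≤
      Real.exp (ε / Real.pi * k - 255 / 1024 / Real.pi * p * S) := by
    have hx : ε / Real.pi ≤ 1 / 2 := by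
      rw [div_le_iff₀ (by positivity)]; linarith
    have hx0 : 0 ≤ ε / Real.pi := by positivity
    -- Lowering the Gaussian weight to `b` costs at most `exp (ε k / π)` in normalisation.
    have h1 : Real.pi / b ≤ Real.exp (2 * (ε / Real.pi)) := by
      have h3 := Real.add_one_le_exp (2 * (ε / Real.pi))
      refine le_trans ?_ h3
      rw [div_le_iff₀ hb0, hb]
      have : (2 * (ε / Real.pi) + 1) * (Real.pi - ε) =
          Real.pi + ε * (1 - 2 * (ε / Real.pi)) := by field_simp; ring
      rw [this]
      have := mul_nonneg hε0 (by linarith : 0 ≤ 1 - 2 * (ε / Real.pi))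
      linarith
    have h3 : (Real.pi / b) ^ ((k : ℝ) / 2) ≤ Real.exp (ε / Real.pi * k) := by
      refine (Real.rpow_le_rpow (by positivity) h1 (by positivity)).trans_eq ?_
      rw [← Real.exp_mul]
      congr 1; ring
    rw [sub_eq_add_neg, Real.exp_add]
    gcongr
    have h5 : S / (2 * Real.pi) ≤ S / (2 * b) := by
      gcongr
      linarith
    have h6 := mul_le_mul_of_nonneg_left h5 (by positivity : 0 ≤ 255 / 256 * p / 2)
    have e3 : 255 / 256 * p / 2 * (S / (2 * Real.pi)) = 255 / 1024 / Real.pi * p * S := by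
      field_simp; ring
    linarith
  have hcont : Continuous fun θ => sqDist ν (B.mulVec (θ - θ₀)) :=
    (continuous_sqDist ν).comp (continuous_const.matrix_mulVec (by fun_prop))
  have hmeas : Measurable fun θ =>
      ENNReal.ofReal (Real.exp (-(p / 2048) * sqDist ν (B.mulVec (θ - θ₀)))) :=
    (ENNReal.continuous_ofReal.comp (by fun_prop)).measurable
  rw [← lintegral_const_mul _ hmeas]
  refine setLIntegral_mono (measurable_const.mul hmeas) fun θ hθ => ?_
  calc ∫⁻ x : Fin k → ℝ, ENNReal.ofReal (Real.exp (-Real.pi * ∑ i, x i ^ 2) *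
        Real.exp (-p * sqDist ν (A.mulVec x + B.mulVec θ)))
      ≤ ∫⁻ x : Fin k → ℝ, ENNReal.ofReal (Real.exp (1 / 2) *
          Real.exp (-(p / 2048) * sqDist ν (B.mulVec (θ - θ₀)))) *
          ENNReal.ofReal (Real.exp (-b * ∑ i, x i ^ 2) *
            Real.exp (-(255 / 256 * p) * sqDist ν (A.mulVec x + B.mulVec θ))) := by
        refine lintegral_mono fun x => ?_
        rw [← ENNReal.ofReal_mul (by positivity)]
        refine ENNReal.ofReal_le_ofReal ?_
        simp only [← Real.exp_add]
        refine Real.exp_le_exp.2 ?_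
        have := hlow x θ hθ
        rw [hb]
        linarith
    _ = ENNReal.ofReal (Real.exp (1 / 2) *
          Real.exp (-(p / 2048) * sqDist ν (B.mulVec (θ - θ₀)))) *
        ∫⁻ x : Fin k → ℝ, ENNReal.ofReal (Real.exp (-b * ∑ i, x i ^ 2) *
            Real.exp (-(255 / 256 * p) * sqDist ν (A.mulVec x + B.mulVec θ))) :=
        lintegral_const_mul' _ _ (by simp)
    _ ≤ ENNReal.ofReal (Real.exp (1 / 2) *
          Real.exp (-(p / 2048) * sqDist ν (B.mulVec (θ - θ₀)))) *
        ENNReal.ofReal (Real.exp (ε / Real.pi * k - 255 / 1024 / Real.pi * p * S)) :=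
        mul_le_mul_right ((hgain (B.mulVec θ)).trans (ENNReal.ofReal_le_ofReal hG)) _
    _ = _ := by
        rw [← ENNReal.ofReal_mul (by positivity), ← ENNReal.ofReal_mul (by positivity)]
        congr 1
        ring

end SmallBall

/-! ### The integral along `[A | Y ⊕ Y]`. -/

namespace SmallBall

instance {n : ℕ} (ν : Fin n → Measure ℝ) [∀ i, IsProbabilityMeasure (ν i)]
    (j : Fin n ⊕ Fin n) : IsProbabilityMeasure (Sum.elim ν ν j) := by
  cases j <;> simp only [Sum.elim_inl, Sum.elim_inr] <;> infer_instance

theorem sqDist_sumElim {n : ℕ} (ν : Fin n → Measure ℝ) (x : Fin n ⊕ Fin n → ℝ) :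
    sqDist (Sum.elim ν ν) x = sqDist ν (x ∘ Sum.inl) + sqDist ν (x ∘ Sum.inr) := by
  simp [sqDist, Fintype.sum_sum_type]

/-- The volume estimate for the level sets of `sqDist` from a lower bound of logarithmic type. -/
theorem lintegral_cube_exp_neg_sqDist_le {n m : ℕ} (hm : 0 < m) (ν : Fin n → Measure ℝ)
    {p γ α : ℝ} (hγ : 0 < γ) (hα : 0 < α) (hp : 2 * 2048 ≤ p * γ ^ 2)
    (Y : Matrix (Fin n) (Fin m) ℝ) {y : Fin m → ℝ} (hy : ∀ i, 0 < y i)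
    (hY : ∀ z : Fin m → ℝ, ∑ i, z i ^ 2 ≤ m →
      γ ^ 2 * m * Real.posLog (α * √(∑ i, y i ^ 2 * z i ^ 2) / (γ * √m)) ≤ sqDist ν (Y.mulVec z))
    (c θ₀ : Fin m ⊕ Fin m → ℝ) (hθ₀ : θ₀ ∈ Set.Icc c (c + 1)) :
    ∫⁻ θ in Set.Icc c (c + 1), ENNReal.ofReal (Real.exp (-(p / 2048) *
        sqDist (Sum.elim ν ν) ((Matrix.fromBlocks Y 0 0 Y).mulVec (θ - θ₀)))) ≤
      ENNReal.ofReal ((2 * Real.pi * γ / α) ^ (2 * m) / ∏ i, y i ^ 2) := by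
  have hm' : (0 : ℝ) < m := by exact_mod_cast hm
  let a : Fin m ⊕ Fin m → ℝ := Sum.elim (fun i => α * y i / γ) (fun i => α * y i / γ)
  have ha : ∀ i, 0 < a i := by
    rintro (i | i) <;> simp only [a, Sum.elim_inl, Sum.elim_inr] <;> have := hy i <;> positivity
  have hp0 : 0 ≤ p := by
    by_contra! h
    nlinarith [sq_nonneg γ]
  have hone : ∀ z : Fin m → ℝ, ∑ i, z i ^ 2 ≤ m →
      Real.exp (-(p / 2048) * sqDist ν (Y.mulVec z)) ≤
        ∏ i, (2 * (1 + (α * y i / γ * z i) ^ 2)⁻¹) := by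
    intro z hz
    -- The hypothesis `hp` is exactly what makes this exponent at least `2m`, the decay needed for
    -- `m` Cauchy factors.
    have hw := exp_neg_posLog_le_prod hm (fun i => α * y i / γ * z i)
      (p := p / 2048 * (γ ^ 2 * m)) (by
        have := mul_le_mul_of_nonneg_right hp hm'.le
        linarith)
    refine le_trans (Real.exp_le_exp.2 ?_) hw
    have h1 := mul_le_mul_of_nonneg_left (hY z hz) (by positivity : 0 ≤ p / 2048)
    have e : √((∑ i, (α * y i / γ * z i) ^ 2) / m) =
        α * √(∑ i, y i ^ 2 * z i ^ 2) / (γ * √m) := by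
      have : (∑ i, (α * y i / γ * z i) ^ 2) = (α / γ) ^ 2 * ∑ i, y i ^ 2 * z i ^ 2 := by
        rw [Finset.mul_sum]
        exact Finset.sum_congr rfl fun i _ => by ring
      rw [this, Real.sqrt_div (by positivity), Real.sqrt_mul (by positivity),
        Real.sqrt_sq (by positivity)]
      field_simp
    rw [e]
    linarith
  obtain ⟨hci, hcv⟩ := integral_prod_cauchy ha
  -- Since `θ₀` lies in the same unit cube, each half of `θ - θ₀` has squared norm at most `m`, the
  -- range covered by `hY`.
  have hcube : ∀ θ ∈ Set.Icc c (c + 1), ∀ j, (θ - θ₀) j ^ 2 ≤ 1 := by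
    intro θ hθ j
    have h1 := hθ.1 j
    have h2 := hθ.2 j
    have h3 := hθ₀.1 j
    have h4 := hθ₀.2 j
    simp only [Pi.add_apply, Pi.one_apply] at h2 h4
    rw [sq_le_one_iff_abs_le_one, abs_le, Pi.sub_apply]
    constructor <;> linarith
  have hmeas : Measurable fun θ : Fin m ⊕ Fin m → ℝ =>
      ENNReal.ofReal (∏ j, (2 * (1 + (a j * (θ - θ₀) j) ^ 2)⁻¹)) := by
    simp only [Pi.sub_apply]
    fun_prop
  have hpt : ∀ θ ∈ Set.Icc c (c + 1), Real.exp (-(p / 2048) *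
      sqDist (Sum.elim ν ν) ((Matrix.fromBlocks Y 0 0 Y).mulVec (θ - θ₀))) ≤
        ∏ j, (2 * (1 + (a j * (θ - θ₀) j) ^ 2)⁻¹) := by
    intro θ hθ
    rw [sqDist_sumElim, mul_add, Real.exp_add, Fintype.prod_sum_type]
    have hb := hcube θ hθ
    have e1 : (Matrix.fromBlocks Y 0 0 Y).mulVec (θ - θ₀) ∘ Sum.inl =
        Y.mulVec fun i => (θ - θ₀) (Sum.inl i) := by
      rw [Matrix.fromBlocks_mulVec]
      ext i
      simp [Function.comp_def]
    have e2 : (Matrix.fromBlocks Y 0 0 Y).mulVec (θ - θ₀) ∘ Sum.inr =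
        Y.mulVec fun i => (θ - θ₀) (Sum.inr i) := by
      rw [Matrix.fromBlocks_mulVec]
      ext i
      simp [Function.comp_def]
    rw [e1, e2]
    refine mul_le_mul (hone _ ?_) (hone _ ?_) (by positivity)
      (Finset.prod_nonneg fun i _ => by positivity)
    · exact (Finset.sum_le_sum fun i _ => hb (Sum.inl i)).trans_eq (by simp)
    · exact (Finset.sum_le_sum fun i _ => hb (Sum.inr i)).trans_eq (by simp)
  have hval : ∫⁻ θ : Fin m ⊕ Fin m → ℝ, ENNReal.ofReal (∏ j, (2 * (1 + (a j * θ j) ^ 2)⁻¹)) =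
      ENNReal.ofReal ((2 * Real.pi * γ / α) ^ (2 * m) / ∏ i, y i ^ 2) := by
    rw [← ofReal_integral_eq_lintegral_ofReal hci
      (ae_of_all _ fun x => Finset.prod_nonneg fun i _ => by positivity), hcv]
    congr 1
    have e : ∏ i, 2 * Real.pi / (α * y i / γ) = (2 * Real.pi * γ / α) ^ m / ∏ i, y i := by
      have : ∀ i, 2 * Real.pi / (α * y i / γ) = (2 * Real.pi * γ / α) / y i := fun i => by
        have := (hy i).ne'
        field_simp
      simp only [this]
      rw [Finset.prod_div_distrib, Finset.prod_const, Finset.card_univ, Fintype.card_fin]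
    rw [Fintype.prod_sum_type]
    simp only [a, Sum.elim_inl, Sum.elim_inr]
    rw [e, Finset.prod_pow, mul_comm 2 m, pow_mul, div_mul_div_comm]
    ring
  rw [← hval, ← lintegral_sub_right_eq_self
    (fun θ : Fin m ⊕ Fin m → ℝ => ENNReal.ofReal (∏ j, (2 * (1 + (a j * θ j) ^ 2)⁻¹))) θ₀]
  exact (setLIntegral_mono hmeas fun θ hθ => ENNReal.ofReal_le_ofReal (hpt θ hθ)).trans
    (setLIntegral_le_lintegral _ _)

/-- The Fourier-analytic core: a bound for the Gaussian integral of `exp (-p ‖·‖²)` along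
`[A | Y ⊕ Y]`. -/
theorem lintegral_gaussian_blockExtend_le {n k m : ℕ} (hm : 0 < m) (ν : Fin n → Measure ℝ)
    [∀ i, IsProbabilityMeasure (ν i)]
    {p γ α M r : ℝ} (hγ : 0 < γ) (hα : 0 < α) (hp0 : 0 ≤ p) (hp : 2 * 2048 ≤ p * γ ^ 2)
    (hr0 : 0 ≤ r) (hpr : 8 * p * r ≤ 1)
    (hi2 : ∀ i, Integrable (fun y => y ^ 2) (ν i)) (h2 : ∀ i, ∫ y, y ^ 2 ∂ν i = 2)
    (hi4 : ∀ i, Integrable (fun y => y ^ 4) (ν i)) (h4 : ∀ i, ∫ y, y ^ 4 ∂ν i ≤ M)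
    (A : Matrix (Fin n ⊕ Fin n) (Fin k) ℝ)
    (hA : ∀ j, 2 * Real.pi ^ 2 * (∑ i, A j i ^ 2) * M ≤ 1)
    (hAr : ∀ z, ∑ j, A.mulVec z j ^ 2 ≤ r * ∑ i, z i ^ 2)
    (Y : Matrix (Fin n) (Fin m) ℝ) {y : Fin m → ℝ} (hy : ∀ i, 0 < y i)
    (hY : ∀ z : Fin m → ℝ, ∑ i, z i ^ 2 ≤ m →
      γ ^ 2 * m * Real.posLog (α * √(∑ i, y i ^ 2 * z i ^ 2) / (γ * √m)) ≤
        sqDist ν (Y.mulVec z)) :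
    ∫⁻ x : Fin k ⊕ (Fin m ⊕ Fin m) → ℝ, ENNReal.ofReal (Real.exp (-Real.pi * ∑ i, x i ^ 2) *
        Real.exp (-p * sqDist (Sum.elim ν ν) ((blockExtend A Y).mulVec x))) ≤
      ENNReal.ofReal ((2 * Real.exp (2 * Real.pi)) ^ m * Real.exp (1 / 2) *
        Real.exp (p * r / 128 / Real.pi * k -
          255 / 1024 / Real.pi * p * (∑ j, ∑ i, A j i ^ 2)) *
        ((2 * Real.pi * γ / α) ^ (2 * m) / ∏ i, y i ^ 2)) := by
  set η := Sum.elim ν ν with hη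
  have hi2' : ∀ i, Integrable (fun y => y ^ 2) (η i) := by rintro (i | i) <;> exact hi2 i
  have h2' : ∀ i, ∫ y, y ^ 2 ∂η i = 2 := by rintro (i | i) <;> exact h2 i
  have hi4' : ∀ i, Integrable (fun y => y ^ 4) (η i) := by rintro (i | i) <;> exact hi4 i
  have h4' : ∀ i, ∫ y, y ^ 4 ∂η i ≤ M := by rintro (i | i) <;> exact h4 i
  let f : (Fin k → ℝ) × (Fin m ⊕ Fin m → ℝ) → ℝ := fun z =>
    Real.exp (-Real.pi * ∑ i, z.1 i ^ 2) *
      Real.exp (-p * sqDist η (A.mulVec z.1 + (Matrix.fromBlocks Y 0 0 Y).mulVec z.2))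
  have hfc : Continuous f := by
    have := (continuous_sqDist η).comp (f := fun z : (Fin k → ℝ) × (Fin m ⊕ Fin m → ℝ) =>
      A.mulVec z.1 + (Matrix.fromBlocks Y 0 0 Y).mulVec z.2)
      ((continuous_const.matrix_mulVec continuous_fst).add
        (continuous_const.matrix_mulVec continuous_snd))
    simp only [f]
    fun_prop
  have hfm : Measurable fun z => ENNReal.ofReal (f z) :=
    (ENNReal.continuous_ofReal.comp hfc).measurable
  set E := Real.exp (p * r / 128 / Real.pi * k -
          255 / 1024 / Real.pi * p * (∑ j, ∑ i, A j i ^ 2)) with hE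
  set V := (2 * Real.pi * γ / α) ^ (2 * m) / ∏ i, y i ^ 2 with hV
  have hcube : ∀ c : Fin m ⊕ Fin m → ℝ,
      ∫⁻ θ in Set.Icc c (c + 1), ∫⁻ x : Fin k → ℝ, ENNReal.ofReal (f (x, θ)) ≤
        ENNReal.ofReal (Real.exp (1 / 2) * E * V) := by
    intro c
    obtain ⟨θ₀, hθ₀, h⟩ := exists_lintegral_decouple_le η hp0 hr0 hpr hi2' h2' hi4' h4' A hA hAr
      (Matrix.fromBlocks Y 0 0 Y) (Q := Set.Icc c (c + 1)) ⟨c, le_rfl, by simp⟩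
    refine h.trans ?_
    rw [ENNReal.ofReal_mul (q := V) (by positivity)]
    gcongr
    exact lintegral_cube_exp_neg_sqDist_le hm ν hγ hα hp Y hy hY c θ₀ hθ₀
  have htile := lintegral_gaussian_mul_le_of_cube
    (F := fun θ => ∫⁻ x : Fin k → ℝ, ENNReal.ofReal (f (x, θ)))
    (Measurable.lintegral_prod_left' hfm) hcube
  rw [← (volume_measurePreserving_sumPiEquivProdPi_symm
    (fun _ : Fin k ⊕ (Fin m ⊕ Fin m) => ℝ)).lintegral_comp_emb
      (MeasurableEquiv.measurableEmbedding _)]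
  rw [Measure.volume_eq_prod, lintegral_prod_symm]
  · calc _ = ∫⁻ θ : Fin m ⊕ Fin m → ℝ, ENNReal.ofReal (Real.exp (-Real.pi * ∑ i, θ i ^ 2)) *
          ∫⁻ x : Fin k → ℝ, ENNReal.ofReal (f (x, θ)) := by
          refine lintegral_congr fun θ => ?_
          rw [← lintegral_const_mul' _ _ (by simp)]
          refine lintegral_congr fun x => ?_
          rw [← ENNReal.ofReal_mul (by positivity)]
          congr 1
          have e1 : (MeasurableEquiv.sumPiEquivProdPi
              (fun _ : Fin k ⊕ (Fin m ⊕ Fin m) => ℝ)).symm (x, θ) = Sum.elim x θ := by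
            ext (i | i) <;> rfl
          rw [e1]
          simp only [f, blockExtend, Matrix.fromCols_mulVec, Fintype.sum_sum_type (α₁ := Fin k),
            Sum.elim_inl, Sum.elim_inr, Sum.elim_comp_inl, Sum.elim_comp_inr, mul_add, Real.exp_add]
          ring
      _ ≤ _ := htile
      _ = _ := by
          rw [← ENNReal.ofReal_mul (by positivity)]
          congr 1
          have hcard : (Fintype.card (Fin m ⊕ Fin m) : ℝ) = 2 * m := by simp; ring
          rw [hcard, mul_div_cancel_left₀ _ (two_ne_zero' ℝ), Real.rpow_natCast, mul_pow,
            ← Real.exp_nat_mul]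
          ring_nf
  · have hc : Continuous fun x : Fin k ⊕ (Fin m ⊕ Fin m) → ℝ =>
        sqDist η ((blockExtend A Y).mulVec x) :=
      (continuous_sqDist η).comp (continuous_const.matrix_mulVec continuous_id)
    have hm2 : Measurable fun x : Fin k ⊕ (Fin m ⊕ Fin m) → ℝ =>
        ENNReal.ofReal (Real.exp (-Real.pi * ∑ i, x i ^ 2) *
          Real.exp (-p * sqDist η ((blockExtend A Y).mulVec x))) :=
      (ENNReal.continuous_ofReal.comp (by fun_prop)).measurable
    exact (hm2.comp (MeasurableEquiv.measurable _)).aemeasurable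

end SmallBall

/-! ### Moments of the symmetrised laws, the `ξ`-norm, and one-dimensional characteristic functions.
-/

namespace SmallBall

section Moments

variable {Ω : Type*} [MeasurableSpace Ω] {P : Measure Ω}

theorem MemS2.integral_sq {T : ℝ} {X : Ω → ℝ} (h : MemS2 P T X) : ∫ ω, X ω ^ 2 ∂P = 1 := by
  have := h.variance_eq_one
  rw [variance_eq_integral h.aemeasurable, h.mean_eq_zero] at this
  simpa using this

/-- The law of `X - X'`, with `X'` an independent copy of `X`. -/
noncomputable def symmLaw (P : Measure Ω) (X : Ω → ℝ) : Measure ℝ :=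
  (P.prod P).map fun p => X p.1 - X p.2

theorem aemeasurable_sub_prod {X : Ω → ℝ} (hX : AEMeasurable X P) :
    AEMeasurable (fun p : Ω × Ω => X p.1 - X p.2) (P.prod P) :=
  (hX.comp_quasiMeasurePreserving Measure.quasiMeasurePreserving_fst).sub
    (hX.comp_quasiMeasurePreserving Measure.quasiMeasurePreserving_snd)

theorem MemS2.lintegral_pow_four_le {T : ℝ} (hT : 1 ≤ T) {X : Ω → ℝ} (h : MemS2 P T X) :
    ∫⁻ ω, ENNReal.ofReal (X ω ^ 4) ∂P ≤ ENNReal.ofReal (64 * T ^ 4) := by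
  -- The infimum need not be attained at `T`; the strict bound by `2 * T` yields an admissible `t`.
  -- Then `X⁴ ≤ 2t⁴ exp((X/t)²)` gives `4 * (2T)⁴ = 64 T⁴`.
  have h1 : psi2Norm P X < ENNReal.ofReal (2 * T) :=
    h.psi2Norm_le.trans_lt ((ENNReal.ofReal_lt_ofReal_iff (by linarith)).2 (by linarith))
  simp only [psi2Norm, iInf_lt_iff] at h1
  obtain ⟨t, ht, hE, htT⟩ := h1
  have htT' : t < 2 * T := (ENNReal.ofReal_lt_ofReal_iff (by linarith)).1 htT
  calc ∫⁻ ω, ENNReal.ofReal (X ω ^ 4) ∂P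
      ≤ ∫⁻ ω, ENNReal.ofReal (2 * t ^ 4) * ENNReal.ofReal (Real.exp ((X ω / t) ^ 2)) ∂P := by
        refine lintegral_mono fun ω => ?_
        rw [← ENNReal.ofReal_mul (by positivity)]
        refine ENNReal.ofReal_le_ofReal ?_
        have h2 := Real.quadratic_le_exp_of_nonneg (sq_nonneg (X ω / t))
        have h3 : X ω ^ 4 = t ^ 4 * ((X ω / t) ^ 2) ^ 2 := by field_simp
        rw [h3]
        nlinarith [pow_pos ht 4, sq_nonneg (X ω / t)]
    _ = ENNReal.ofReal (2 * t ^ 4) * ∫⁻ ω, ENNReal.ofReal (Real.exp ((X ω / t) ^ 2)) ∂P :=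
        lintegral_const_mul' _ _ ENNReal.ofReal_ne_top
    _ ≤ ENNReal.ofReal (2 * t ^ 4) * ENNReal.ofReal 2 := by
        gcongr
        simpa using hE
    _ ≤ _ := by
        rw [← ENNReal.ofReal_mul (by positivity)]
        refine ENNReal.ofReal_le_ofReal ?_
        have := pow_le_pow_left₀ ht.le htT'.le 4
        nlinarith

theorem MemS2.integrable_pow_four {T : ℝ} (hT : 1 ≤ T) {X : Ω → ℝ} (h : MemS2 P T X) :
    Integrable (fun ω => X ω ^ 4) P := by
  refine ⟨(h.aemeasurable.pow_const 4).aestronglyMeasurable, ?_⟩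
  rw [hasFiniteIntegral_iff_ofReal (ae_of_all _ fun ω => by positivity)]
  exact (h.lintegral_pow_four_le hT).trans_lt ENNReal.ofReal_lt_top

theorem MemS2.integral_pow_four_le {T : ℝ} (hT : 1 ≤ T) {X : Ω → ℝ} (h : MemS2 P T X) :
    ∫ ω, X ω ^ 4 ∂P ≤ 64 * T ^ 4 := by
  have h1 := h.lintegral_pow_four_le hT
  rw [← ofReal_integral_eq_lintegral_ofReal (h.integrable_pow_four hT)
    (ae_of_all _ fun ω => by positivity)] at h1
  exact (ENNReal.ofReal_le_ofReal_iff (by positivity)).1 h1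

theorem integral_symmLaw {X : Ω → ℝ} (hX : AEMeasurable X P) {f : ℝ → ℝ} (hf : Measurable f) :
    ∫ y, f y ∂symmLaw P X = ∫ p : Ω × Ω, f (X p.1 - X p.2) ∂(P.prod P) :=
  integral_map (aemeasurable_sub_prod hX) hf.aestronglyMeasurable

theorem integrable_symmLaw {X : Ω → ℝ} (hX : AEMeasurable X P) {f : ℝ → ℝ} (hf : Measurable f) :
    Integrable f (symmLaw P X) ↔ Integrable (fun p : Ω × Ω => f (X p.1 - X p.2)) (P.prod P) :=
  integrable_map_measure hf.aestronglyMeasurable (aemeasurable_sub_prod hX)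

variable [IsProbabilityMeasure P]

theorem MemS2.integrable_sq {T : ℝ} (hT : 1 ≤ T) {X : Ω → ℝ} (h : MemS2 P T X) :
    Integrable (fun ω => X ω ^ 2) P := by
  refine ((integrable_const (1 : ℝ)).add (h.integrable_pow_four hT)).mono'
    (h.aemeasurable.pow_const 2).aestronglyMeasurable (ae_of_all _ fun ω => ?_)
  rw [Real.norm_of_nonneg (by positivity), Pi.add_apply]
  nlinarith [sq_nonneg (X ω ^ 2 - 1)]

theorem MemS2.integrable {T : ℝ} (hT : 1 ≤ T) {X : Ω → ℝ} (h : MemS2 P T X) :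
    Integrable X P := by
  refine ((integrable_const (1 : ℝ)).add (h.integrable_sq hT)).mono'
    h.aemeasurable.aestronglyMeasurable (ae_of_all _ fun ω => ?_)
  rw [Real.norm_eq_abs, Pi.add_apply, abs_le]
  constructor <;> nlinarith [sq_nonneg (X ω + 1), sq_nonneg (X ω - 1)]

theorem isProbabilityMeasure_symmLaw {X : Ω → ℝ} (hX : AEMeasurable X P) :
    IsProbabilityMeasure (symmLaw P X) :=
  Measure.isProbabilityMeasure_map (aemeasurable_sub_prod hX)

theorem MemS2.symmLaw_sq {T : ℝ} (hT : 1 ≤ T) {X : Ω → ℝ} (h : MemS2 P T X) :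
    Integrable (fun y => y ^ 2) (symmLaw P X) ∧ ∫ y, y ^ 2 ∂symmLaw P X = 2 := by
  have hm : Measurable fun y : ℝ => y ^ 2 := by fun_prop
  rw [integral_symmLaw h.aemeasurable hm, integrable_symmLaw h.aemeasurable hm]
  have e : (fun p : Ω × Ω => (X p.1 - X p.2) ^ 2) =
      fun p => X p.1 ^ 2 + X p.2 ^ 2 - 2 * (X p.1 * X p.2) := by ext p; ring
  rw [e]
  have i1 := (h.integrable_sq hT).comp_fst P
  have i2 := (h.integrable_sq hT).comp_snd P
  have i3 := ((h.integrable hT).mul_prod (h.integrable hT)).const_mul 2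
  refine ⟨(i1.add i2).sub i3, ?_⟩
  rw [integral_sub (by exact i1.add i2) i3, integral_add i1 i2, integral_const_mul, integral_prod_mul,
    integral_fun_fst (fun ω => X ω ^ 2), integral_fun_snd (fun ω => X ω ^ 2), h.integral_sq,
    h.mean_eq_zero]
  simp
  norm_num

theorem MemS2.symmLaw_pow_four {T : ℝ} (hT : 1 ≤ T) {X : Ω → ℝ} (h : MemS2 P T X) :
    Integrable (fun y => y ^ 4) (symmLaw P X) ∧
      ∫ y, y ^ 4 ∂symmLaw P X ≤ 1024 * T ^ 4 := by
  have hm : Measurable fun y : ℝ => y ^ 4 := by fun_prop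
  rw [integral_symmLaw h.aemeasurable hm, integrable_symmLaw h.aemeasurable hm]
  have i1 := (h.integrable_pow_four hT).comp_fst P
  have i2 := (h.integrable_pow_four hT).comp_snd P
  have hle : ∀ p : Ω × Ω, (X p.1 - X p.2) ^ 4 ≤ 8 * (X p.1 ^ 4 + X p.2 ^ 4) := fun p => by
    nlinarith [sq_nonneg (X p.1 ^ 2 - X p.2 ^ 2), sq_nonneg (X p.1 + X p.2),
      sq_nonneg (X p.1 - X p.2), sq_nonneg ((X p.1 + X p.2) ^ 2), sq_nonneg (X p.1 * X p.2),
      mul_nonneg (sq_nonneg (X p.1 + X p.2)) (sq_nonneg (X p.1 - X p.2)),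
      sq_nonneg ((X p.1 + X p.2) ^ 2 - (X p.1 - X p.2) ^ 2)]
  have i3 : Integrable (fun p : Ω × Ω => (X p.1 - X p.2) ^ 4) (P.prod P) := by
    refine ((i1.add i2).const_mul 8).mono'
      ((aemeasurable_sub_prod h.aemeasurable).pow_const 4).aestronglyMeasurable
      (ae_of_all _ fun p => ?_)
    rw [Real.norm_of_nonneg (by positivity)]
    exact hle p
  refine ⟨i3, (integral_mono i3 ((i1.add i2).const_mul 8) hle).trans ?_⟩
  rw [integral_const_mul]
  simp only [Pi.add_apply]
  rw [integral_add i1 i2, integral_fun_fst (fun ω => X ω ^ 4), integral_fun_snd (fun ω => X ω ^ 4)]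
  have := h.integral_pow_four_le hT
  simp only [probReal_univ, one_smul]
  linarith

end Moments

/-- Rounding each coordinate gives a nearest lattice point. -/
theorem infDist_intLattice_sq {n : ℕ} (z : Fin n → ℝ) :
    Metric.infDist (WithLp.toLp 2 z) (intLattice n) ^ 2 = ∑ i, intDist (z i) ^ 2 := by
  have hmem : (WithLp.toLp 2 fun i => (round (z i) : ℝ)) ∈ intLattice n :=
    ⟨fun i => round (z i), fun i => rfl⟩
  have h : Metric.infDist (WithLp.toLp 2 z) (intLattice n) = √(∑ i, intDist (z i) ^ 2) := by
    refine le_antisymm ((Metric.infDist_le_dist_of_mem hmem).trans_eq ?_)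
      ((Metric.le_infDist ⟨_, hmem⟩).2 fun w hw => ?_)
    · rw [EuclideanSpace.dist_eq]
      rfl
    · obtain ⟨a, ha⟩ := hw
      rw [EuclideanSpace.dist_eq]
      refine Real.sqrt_le_sqrt (Finset.sum_le_sum fun i _ => ?_)
      refine pow_le_pow_left₀ (intDist_nonneg _) ?_ 2
      rw [ha i, Real.dist_eq]
      exact round_le _ _
  rw [h, Real.sq_sqrt (by positivity)]

variable {Ω : Type*} [MeasurableSpace Ω] {P : Measure Ω} [IsProbabilityMeasure P]

theorem xiNorm_sq {n : ℕ} {ξ : Ω → Fin n → ℝ} (hξ : ∀ i, AEMeasurable (fun ω => ξ ω i) P)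
    (x : Fin n → ℝ) :
    xiNorm P ξ x ^ 2 = sqDist (fun i => symmLaw P fun ω => ξ ω i) x := by
  rw [xiNorm, Real.sq_sqrt (integral_nonneg fun _ => by positivity)]
  simp only [infDist_intLattice_sq]
  rw [integral_finsetSum, sqDist]
  · refine Finset.sum_congr rfl fun i _ => ?_
    rw [integral_symmLaw (hξ i) (f := fun y => intDist (x i * y) ^ 2)
      ((measurable_intDist.comp (by fun_prop)).pow_const 2)]
  · exact fun i _ => integrable_intDist_sq _ ((aemeasurable_sub_prod (hξ i)).const_mul _)

section CharFun

open Complex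

/-- Symmetrisation: `‖φ‖²` is the mean of `cos` under the law of `X - X'`, so it is at most one
minus eight times the mean of `intDist²`; the final step is `2‖φ‖ ≤ 1 + ‖φ‖²`. -/
theorem norm_integral_cexp_le {X : Ω → ℝ} (hX : AEMeasurable X P) (x : ℝ) :
    ‖∫ ω, cexp ((2 * Real.pi * (x * X ω) : ℝ) * I) ∂P‖ ≤
      1 - 4 * ∫ y, intDist (x * y) ^ 2 ∂symmLaw P X := by
  set φ := ∫ ω, cexp ((2 * Real.pi * (x * X ω) : ℝ) * I) ∂P with hφ
  have hprob := isProbabilityMeasure_symmLaw hX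
  have h1 : (‖φ‖ ^ 2 : ℝ) = ∫ y, Real.cos (2 * Real.pi * (x * y)) ∂symmLaw P X := by
    have h2 : ((‖φ‖ ^ 2 : ℝ) : ℂ) =
        ∫ p : Ω × Ω, cexp ((2 * Real.pi * (x * (X p.1 - X p.2)) : ℝ) * I) ∂(P.prod P) := by
      have hconj : (starRingEnd ℂ) φ = ∫ ω, cexp (-((2 * Real.pi * (x * X ω) : ℝ) * I)) ∂P := by
        rw [hφ, ← integral_conj]
        refine integral_congr_ae (ae_of_all _ fun ω => ?_)
        simp only
        rw [← Complex.exp_conj, map_mul, Complex.conj_ofReal, Complex.conj_I, mul_neg]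
      rw [Complex.ofReal_pow, ← Complex.mul_conj', hconj, hφ, ← integral_prod_mul]
      refine integral_congr_ae (ae_of_all _ fun p => ?_)
      simp only
      rw [← Complex.exp_add]
      congr 1
      push_cast
      ring
    have h3 := congrArg Complex.re h2
    rw [Complex.ofReal_re] at h3
    rw [h3, integral_symmLaw hX (by fun_prop), ← RCLike.re_eq_complex_re, ← integral_re]
    · refine integral_congr_ae (ae_of_all _ fun p => ?_)
      simp only [RCLike.re_eq_complex_re]
      rw [Complex.exp_ofReal_mul_I_re]
    · have hm := aemeasurable_sub_prod (P := P) hX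
      refine Integrable.of_bound (C := 1) (AEMeasurable.aestronglyMeasurable (by fun_prop))
        (ae_of_all _ fun p => ?_)
      rw [Complex.norm_exp_ofReal_mul_I]
  have hi1 := integrable_intDist_sq (symmLaw P X) (f := fun y => x * y) (by fun_prop)
  have hi2 : Integrable (fun y => Real.cos (2 * Real.pi * (x * y))) (symmLaw P X) :=
    Integrable.of_bound (C := 1) (Continuous.aestronglyMeasurable (by fun_prop))
      (ae_of_all _ fun y => by simpa using Real.abs_cos_le_one _)
  have h4 : 8 * ∫ y, intDist (x * y) ^ 2 ∂symmLaw P X ≤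
      1 - ∫ y, Real.cos (2 * Real.pi * (x * y)) ∂symmLaw P X := by
    have := integral_mono (hi1.const_mul 8) ((integrable_const 1).sub hi2)
      fun y => eight_mul_intDist_sq_le (x * y)
    rw [integral_const_mul] at this
    simp only [Pi.sub_apply] at this
    rw [integral_sub (integrable_const 1) hi2] at this
    simpa using this
  nlinarith [sq_nonneg (‖φ‖ - 1)]

/-- The two prescribed masses add up to 1, so the law lives on `{0, 1}`; there `f` agrees with a
constant plus an indicator, which is why no measurability of `f` is needed. -/
theorem integral_bernoulli {δ : Ω → ℝ} {μ : ℝ} (hδ : AEMeasurable δ P) (hμ0 : 0 ≤ μ) (hμ1 : μ ≤ 1)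
    (h1 : P {ω | δ ω = 1} = ENNReal.ofReal μ) (h0 : P {ω | δ ω = 0} = ENNReal.ofReal (1 - μ)) (f : ℝ → ℂ) :
    ∫ y, f y ∂(P.map δ) = (1 - μ) * f 0 + μ * f 1 := by
  have hprob : IsProbabilityMeasure (P.map δ) := Measure.isProbabilityMeasure_map hδ
  have e1 : P.map δ {1} = ENNReal.ofReal μ := by
    rw [Measure.map_apply_of_aemeasurable hδ (measurableSet_singleton _), ← h1]; rfl
  have e0 : P.map δ {0} = ENNReal.ofReal (1 - μ) := by
    rw [Measure.map_apply_of_aemeasurable hδ (measurableSet_singleton _), ← h0]; rfl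
  have hae : ∀ᵐ y ∂(P.map δ), y = 0 ∨ y = 1 := by
    have : P.map δ ({0} ∪ {1}) = 1 := by
      rw [measure_union (by simp) (measurableSet_singleton _), e0, e1,
        ← ENNReal.ofReal_add (by linarith) hμ0]
      simp
    rw [← prob_compl_eq_zero_iff (by measurability)] at this
    exact this
  have hcongr : f =ᵐ[P.map δ] fun y => f 0 + ({1} : Set ℝ).indicator (fun _ => f 1 - f 0) y := by
    filter_upwards [hae] with y hy
    rcases hy with rfl | rfl <;> simp
  rw [integral_congr_ae hcongr, integral_add (integrable_const _)
    ((integrable_const _).indicator (measurableSet_singleton _)),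
    integral_indicator_const _ (measurableSet_singleton _), measureReal_def, e1,
    ENNReal.toReal_ofReal hμ0]
  simp
  ring

end CharFun

end SmallBall

/-! ### Esseen's inequality and the characteristic function of `τ`. -/

namespace SmallBall

open Complex

/-- Esseen's inequality with a Gaussian weight. -/
theorem measureReal_ball_le_integral_charFun {κ : Type*} [Fintype κ] (m : Measure (κ → ℝ))
    [IsProbabilityMeasure m] (t : ℝ) :
    ENNReal.ofReal (m.real {z | ∑ i, z i ^ 2 ≤ t ^ 2}) ≤ ENNReal.ofReal (Real.exp (Real.pi * t ^ 2)) *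
      ∫⁻ x : κ → ℝ, ENNReal.ofReal (Real.exp (-Real.pi * ∑ i, x i ^ 2) *
        ‖∫ z, cexp ((2 * Real.pi * ∑ i, x i * z i : ℝ) * I) ∂m‖) := by
  have hπ := Real.pi_pos
  have hmeas : MeasurableSet {z : κ → ℝ | ∑ i, z i ^ 2 ≤ t ^ 2} :=
    measurableSet_le (by fun_prop) measurable_const
  have hgi : Integrable (fun z : κ → ℝ => Real.exp (-Real.pi * ∑ i, z i ^ 2)) m := by
    refine Integrable.of_bound (C := 1) (Continuous.aestronglyMeasurable (by fun_prop))
      (ae_of_all _ fun z => ?_)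
    rw [Real.norm_of_nonneg (by positivity), Real.exp_le_one_iff]
    have : 0 ≤ ∑ i, z i ^ 2 := by positivity
    nlinarith
  have hmarkov : m.real {z | ∑ i, z i ^ 2 ≤ t ^ 2} ≤
      Real.exp (Real.pi * t ^ 2) * ∫ z, Real.exp (-Real.pi * ∑ i, z i ^ 2) ∂m := by
    rw [← integral_const_mul, ← integral_indicator_one hmeas]
    refine integral_mono ((integrable_const 1).indicator hmeas) (hgi.const_mul _) fun z => ?_
    simp only [Set.indicator, Set.mem_ofPred_eq, Pi.one_apply]
    split_ifs with h
    · rw [← Real.exp_add, Real.one_le_exp_iff]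
      nlinarith
    · positivity
  have hprod : Integrable (fun p : (κ → ℝ) × (κ → ℝ) =>
      (Real.exp (-Real.pi * ∑ i, p.2 i ^ 2) : ℂ) *
        cexp ((2 * Real.pi * ∑ i, p.2 i * p.1 i : ℝ) * I)) (m.prod volume) := by
    refine (((integrable_exp_neg_mul_sum_sq hπ).ofReal (𝕜 := ℂ)).comp_snd m).mul_bdd (c := 1)
      (Continuous.aestronglyMeasurable (by fun_prop)) (ae_of_all _ fun p => ?_)
    rw [Complex.norm_exp_ofReal_mul_I]
  -- The Gaussian `exp (-π|z|²)` is its own Fourier transform; Fubini moves the transform onto `m`.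
  have hfour : ((∫ z, Real.exp (-Real.pi * ∑ i, z i ^ 2) ∂m : ℝ) : ℂ) =
      ∫ x : κ → ℝ, (Real.exp (-Real.pi * ∑ i, x i ^ 2) : ℂ) *
        ∫ z, cexp ((2 * Real.pi * ∑ i, x i * z i : ℝ) * I) ∂m := by
    rw [← integral_complex_ofReal]
    simp only [← integral_const_mul]
    rw [← integral_integral_swap hprod]
    refine integral_congr_ae (ae_of_all _ fun z => ?_)
    have h := integral_exp_neg_mul_sum_sq_mul_cexp hπ (fun i => 2 * Real.pi * z i)
    have e : ∀ x : κ → ℝ, ∑ i, 2 * Real.pi * z i * x i = 2 * Real.pi * ∑ i, x i * z i := by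
      intro x
      rw [Finset.mul_sum]
      exact Finset.sum_congr rfl fun i _ => by ring
    simp only [e] at h
    simp only
    rw [h, div_self hπ.ne', Real.one_rpow, one_mul]
    congr 2
    simp only [mul_pow, ← Finset.mul_sum]
    field_simp
    norm_num
  have hle : ∫ z, Real.exp (-Real.pi * ∑ i, z i ^ 2) ∂m ≤
      ∫ x : κ → ℝ, Real.exp (-Real.pi * ∑ i, x i ^ 2) *
        ‖∫ z, cexp ((2 * Real.pi * ∑ i, x i * z i : ℝ) * I) ∂m‖ := by
    have h1 := congrArg norm hfour
    rw [Complex.norm_real, Real.norm_of_nonneg (integral_nonneg fun z => by positivity)] at h1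
    rw [h1]
    refine (norm_integral_le_integral_norm _).trans_eq ?_
    refine integral_congr_ae (ae_of_all _ fun x => ?_)
    simp only
    rw [norm_mul, Complex.norm_real, Real.norm_of_nonneg (by positivity)]
  have hfi : Integrable fun x : κ → ℝ => Real.exp (-Real.pi * ∑ i, x i ^ 2) *
        ‖∫ z, cexp ((2 * Real.pi * ∑ i, x i * z i : ℝ) * I) ∂m‖ := by
    refine hprod.integral_prod_right.norm.congr (ae_of_all _ fun x => ?_)
    simp only [integral_const_mul]
    rw [norm_mul, Complex.norm_real, Real.norm_of_nonneg (by positivity)]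
  rw [← ofReal_integral_eq_lintegral_ofReal hfi (ae_of_all _ fun x => by positivity),
    ← ENNReal.ofReal_mul (by positivity)]
  refine ENNReal.ofReal_le_ofReal (hmarkov.trans ?_)
  gcongr

variable {Ω : Type*} [MeasurableSpace Ω] {P : Measure Ω} [IsProbabilityMeasure P]

/-- The characteristic function of `τ ∈ Φ_μ(ι, η)`, as a mean over `η`. -/
theorem MemPhi.integral_cexp {ι : Type*} [Fintype ι] {μ : ℝ} {η τ : Ω → ι → ℝ}
    (h : MemPhi P μ η τ) (hη : AEMeasurable η P) (hμ0 : 0 ≤ μ) (hμ1 : μ ≤ 1) (x : ι → ℝ) :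
    ∫ ω, cexp ((2 * Real.pi * ∑ j, x j * τ ω j : ℝ) * I) ∂P =
      ∫ ω, ∏ j, ((1 - μ) + μ * cexp ((2 * Real.pi * (x j * η ω j) : ℝ) * I)) ∂P := by
  obtain ⟨δ, hδm, hδ, hδi, hind, hτ⟩ := h
  have hδm' : AEMeasurable δ P := aemeasurable_pi_iff.2 hδm
  have hpm : ∀ j, IsProbabilityMeasure (P.map fun ω => δ ω j) := fun j =>
    Measure.isProbabilityMeasure_map (hδm j)
  have hpη : IsProbabilityMeasure (P.map η) := Measure.isProbabilityMeasure_map hη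
  have hpδ : IsProbabilityMeasure (P.map δ) := Measure.isProbabilityMeasure_map hδm'
  have hpi : P.map δ = Measure.pi fun j => P.map fun ω => δ ω j :=
    (iIndepFun_iff_map_fun_eq_pi_map hδm).1 hδi
  have hjoint := (indepFun_iff_map_prod_eq_prod_map_map hδm' hη).1 hind
  let F : (ι → ℝ) × (ι → ℝ) → ℂ := fun p => ∏ j, cexp ((2 * Real.pi * (x j * (p.1 j * p.2 j)) : ℝ) * I)
  have hF : Continuous F := by
    simp only [F]
    fun_prop
  have hFi : Integrable F ((P.map δ).prod (P.map η)) := by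
    refine Integrable.of_bound (C := 1) hF.aestronglyMeasurable (ae_of_all _ fun p => ?_)
    simp only [F, norm_prod, Complex.norm_exp_ofReal_mul_I, Finset.prod_const_one, le_refl]
  calc ∫ ω, cexp ((2 * Real.pi * ∑ j, x j * τ ω j : ℝ) * I) ∂P
      = ∫ ω, F (δ ω, η ω) ∂P := by
        refine integral_congr_ae ?_
        filter_upwards [ae_all_iff.2 hτ] with ω hω
        simp only [F, ← Complex.exp_sum, hω]
        congr 1
        push_cast
        rw [Finset.mul_sum, Finset.sum_mul]
    _ = ∫ p, F p ∂((P.map δ).prod (P.map η)) := by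
        rw [← hjoint, integral_map (hδm'.prodMk hη) hF.aestronglyMeasurable]
    _ = ∫ y, ∫ d, F (d, y) ∂(P.map δ) ∂(P.map η) := integral_prod_symm _ hFi
    _ = ∫ y, ∏ j, ((1 - μ) + μ * cexp ((2 * Real.pi * (x j * y j) : ℝ) * I)) ∂(P.map η) := by
        refine integral_congr_ae (ae_of_all _ fun y => ?_)
        simp only [F]
        rw [hpi, integral_fintype_prod_eq_prod
          (fun j (d : ℝ) => cexp ((2 * Real.pi * (x j * (d * y j)) : ℝ) * I))]
        refine Finset.prod_congr rfl fun j _ => ?_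
        rw [integral_bernoulli (hδm j) hμ0 hμ1 (hδ j).1 (hδ j).2]
        simp
    _ = _ := integral_map hη (Continuous.aestronglyMeasurable (by fun_prop))

/-- Averaging over the `δ_j` leaves a product over the coordinates of `(ξ, ξ')`. It factorises
because the halves are independent with the same law and the coordinates of `ξ` are independent.
Each factor is at most `1 - μ + μ‖φ‖ ≤ 1 - 4μD ≤ exp (-4μD)`. -/
theorem norm_integral_cexp_le_exp_neg_sqDist {n : ℕ} {T μ : ℝ} {ξ ξ' : Ω → Fin n → ℝ}
    {τ : Ω → Fin n ⊕ Fin n → ℝ} (hξ : MemG P T ξ) (hcopy : IsIndepCopy P ξ ξ')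
    (hτ : MemPhi P μ (pairVec ξ ξ') τ) (hμ0 : 0 ≤ μ) (hμ1 : μ ≤ 1) (x : Fin n ⊕ Fin n → ℝ) :
    ‖∫ ω, cexp ((2 * Real.pi * ∑ j, x j * τ ω j : ℝ) * I) ∂P‖ ≤
      Real.exp (-(4 * μ) * sqDist (Sum.elim (fun i => symmLaw P fun ω => ξ ω i)
        (fun i => symmLaw P fun ω => ξ ω i)) x) := by
  have hξm : ∀ i, AEMeasurable (fun ω => ξ ω i) P := fun i => (hξ.memS2 i).aemeasurable
  have hξm' : AEMeasurable ξ P := aemeasurable_pi_iff.2 hξm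
  have hξ'm : AEMeasurable ξ' P := hcopy.identDistrib.aemeasurable_fst
  have hη : AEMeasurable (pairVec ξ ξ') P := by
    refine aemeasurable_pi_iff.2 ?_
    rintro (i | i)
    · exact hξm i
    · exact aemeasurable_pi_iff.1 hξ'm i
  rw [hτ.integral_cexp hη hμ0 hμ1]
  let G : (Fin n → ℝ) → (Fin n → ℝ) → ℂ := fun a y =>
    ∏ j, ((1 - μ) + μ * cexp ((2 * Real.pi * (a j * y j) : ℝ) * I))
  have hG : ∀ a, Continuous (G a) := fun a => by
    simp only [G]
    fun_prop
  have hsplit : ∫ ω, ∏ j, ((1 - μ) + μ * cexp ((2 * Real.pi * (x j * pairVec ξ ξ' ω j) : ℝ) * I)) ∂P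
      = (∫ ω, G (x ∘ Sum.inl) (ξ ω) ∂P) * ∫ ω, G (x ∘ Sum.inr) (ξ ω) ∂P := by
    have e : ∫ ω, G (x ∘ Sum.inr) (ξ ω) ∂P = ∫ ω, G (x ∘ Sum.inr) (ξ' ω) ∂P :=
      (hcopy.identDistrib.comp (hG _).measurable).integral_eq.symm
    rw [e, ← hcopy.indep.integral_fun_comp_mul_comp hξm' hξ'm (hG _).aestronglyMeasurable
      (hG _).aestronglyMeasurable]
    refine integral_congr_ae (ae_of_all _ fun ω => ?_)
    simp only [Fintype.prod_sum_type]
    rfl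
  have hbound : ∀ a : Fin n → ℝ, ‖∫ ω, G a (ξ ω) ∂P‖ ≤
      Real.exp (-(4 * μ) * sqDist (fun i => symmLaw P fun ω => ξ ω i) a) := by
    intro a
    have h1 := hξ.indep.integral_fun_prod_comp (𝕜 := ℂ)
      (f := fun j (y : ℝ) => (1 - μ) + μ * cexp ((2 * Real.pi * (a j * y) : ℝ) * I)) hξm
      fun i => Continuous.aestronglyMeasurable (by fun_prop)
    have h2 : ∫ ω, G a (ξ ω) ∂P = ∏ j, ∫ ω, ((1 - μ) + μ *
        cexp ((2 * Real.pi * (a j * ξ ω j) : ℝ) * I)) ∂P := h1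
    rw [h2, norm_prod, sqDist, Finset.mul_sum, Real.exp_sum]
    refine Finset.prod_le_prod (fun _ _ => norm_nonneg _) fun j _ => ?_
    have hi : Integrable (fun ω => cexp ((2 * Real.pi * (a j * ξ ω j) : ℝ) * I)) P := by
      have := hξm j
      refine Integrable.of_bound (C := 1) (AEMeasurable.aestronglyMeasurable (by fun_prop))
        (ae_of_all _ fun p => ?_)
      rw [Complex.norm_exp_ofReal_mul_I]
    rw [integral_add (integrable_const _) (hi.const_mul _), integral_const_mul]
    have h3 := norm_integral_cexp_le (hξm j) (a j)
    set φ := ∫ ω, cexp ((2 * Real.pi * (a j * ξ ω j) : ℝ) * I) ∂P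
    set D := ∫ y, intDist (a j * y) ^ 2 ∂symmLaw P fun ω => ξ ω j
    calc ‖(∫ _, (1 - μ : ℂ) ∂P) + μ * φ‖ ≤ ‖((1 - μ : ℝ) : ℂ)‖ + ‖(μ : ℂ) * φ‖ := by
          refine (norm_add_le _ _).trans_eq ?_
          simp
      _ = (1 - μ) + μ * ‖φ‖ := by
          rw [Complex.norm_real, norm_mul, Complex.norm_real, Real.norm_of_nonneg (by linarith),
            Real.norm_of_nonneg hμ0]
      _ ≤ -(4 * μ) * D + 1 := by nlinarith
      _ ≤ _ := Real.add_one_le_exp _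
  rw [hsplit, norm_mul, sqDist_sumElim, mul_add, Real.exp_add]
  exact mul_le_mul (hbound _) (hbound _) (norm_nonneg _) (Real.exp_pos _).le

end SmallBall

/-! ### Matrix bounds, use of `RlogD`, and Esseen's inequality for the block matrix. -/

namespace SmallBall

theorem sum_mulVec_sq_le_of_opNorm_le {ι κ : Type*} [Fintype ι] [Fintype κ] [DecidableEq κ]
    {W : Matrix ι κ ℝ} {K : ℝ} (hW : opNorm W ≤ K) (z : κ → ℝ) :
    ∑ j, W.mulVec z j ^ 2 ≤ K ^ 2 * ∑ i, z i ^ 2 := by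
  have h := ((Matrix.toEuclideanLin W).toContinuousLinearMap).le_of_opNorm_le hW
    (WithLp.toLp 2 z)
  have h2 := pow_le_pow_left₀ (norm_nonneg _) h 2
  rw [mul_pow, EuclideanSpace.norm_sq_eq, EuclideanSpace.norm_sq_eq] at h2
  simpa using h2

/-- Apply `W` to its own row `W j`: coordinate `j` of the result is `r = |W j|²`, whence `r² ≤ K²
r`. -/
theorem sum_row_sq_le_of_opNorm_le {ι κ : Type*} [Fintype ι] [Fintype κ] [DecidableEq κ]
    {W : Matrix ι κ ℝ} {K : ℝ} (hW : opNorm W ≤ K) (j : ι) : ∑ i, W j i ^ 2 ≤ K ^ 2 := by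
  have h := sum_mulVec_sq_le_of_opNorm_le hW (W j)
  have h1 : W.mulVec (W j) j = ∑ i, W j i ^ 2 := by
    simp [Matrix.mulVec, dotProduct, sq]
  have h2 := (Finset.single_le_sum (f := fun j' => W.mulVec (W j) j' ^ 2)
    (fun _ _ => sq_nonneg _) (Finset.mem_univ j)).trans h
  simp only [h1] at h2
  set r := ∑ i, W j i ^ 2
  have hr : 0 ≤ r := by positivity
  rcases hr.eq_or_lt with h0 | h0
  · rw [← h0]; positivity
  · nlinarith

/-- A vector `z` violating the bound would be admissible in the infimum defining `RlogD`, with norm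
at most `√m`, below the assumed `16√m`. The transpose appears because `RlogD` weights by rows. -/
theorem posLog_le_xiNorm_of_lt_RlogD {Ω : Type*} [MeasurableSpace Ω] {P : Measure Ω} {n m : ℕ}
    {ξ : Ω → Fin n → ℝ} {γ α : ℝ} (hγ : 0 ≤ γ) {Y : Matrix (Fin n) (Fin m) ℝ}
    (hR : ENNReal.ofReal (16 * √(m : ℝ)) < RlogD P ξ (γ * √(m : ℝ)) α Y.transpose)
    (z : Fin m → ℝ) (hz : ∑ i, z i ^ 2 ≤ m) :
    γ ^ 2 * m * Real.posLog (α * √(∑ i, ‖WithLp.toLp 2 (Y.col i)‖ ^ 2 * z i ^ 2) / (γ * √m)) ≤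
      xiNorm P ξ (Y.mulVec z) ^ 2 := by
  have h1 : ‖WithLp.toLp 2 z‖ ≤ 16 * √(m : ℝ) := by
    rw [EuclideanSpace.norm_eq]
    have : √(∑ i, ‖(WithLp.toLp 2 z : EuclideanSpace ℝ (Fin m)) i‖ ^ 2) ≤ √(m : ℝ) :=
      Real.sqrt_le_sqrt (by simpa using hz)
    linarith [Real.sqrt_nonneg (m : ℝ)]
  have h2 : ¬ xiNorm P ξ (Matrix.mulVec Y.transpose.transpose z) <
      γ * √(m : ℝ) * √(Real.posLog (α * rowWeightedNorm Y.transpose z / (γ * √(m : ℝ)))) := by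
    intro hlt
    refine hR.not_ge ?_
    exact (iInf₂_le z hlt).trans (ENNReal.ofReal_le_ofReal h1)
  rw [not_lt, Matrix.transpose_transpose] at h2
  have h3 := pow_le_pow_left₀ (by positivity) h2 2
  rw [mul_pow, mul_pow, Real.sq_sqrt (Nat.cast_nonneg m), Real.sq_sqrt Real.posLog_nonneg] at h3
  exact h3

/-- The law of `Xᵀ τ - w`, after rescaling the `W`-block, concentrates at least as much. -/
theorem norm_blockExtend_sub_sq_ge {n k m : ℕ} (W : Matrix (Fin n ⊕ Fin n) (Fin k) ℝ)
    (Y : Matrix (Fin n) (Fin m) ℝ) {s : ℝ} (hs0 : 0 ≤ s) (hs1 : s ≤ 1)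
    (t : Fin n ⊕ Fin n → ℝ) (w : EuclideanSpace ℝ (Fin k ⊕ (Fin m ⊕ Fin m))) :
    ∑ i, ((blockExtend (s • W) Y).transpose.mulVec t i -
        Sum.elim (fun i => s * w (Sum.inl i)) (fun i => w (Sum.inr i)) i) ^ 2 ≤
      ‖WithLp.toLp 2 ((blockExtend W Y).transpose.mulVec t) - w‖ ^ 2 := by
  rw [EuclideanSpace.norm_sq_eq]
  refine Finset.sum_le_sum fun i _ => ?_
  rw [Real.norm_eq_abs, sq_abs]
  rcases i with i | i
  · have e : (blockExtend (s • W) Y).transpose.mulVec t (Sum.inl i) =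
        s * (blockExtend W Y).transpose.mulVec t (Sum.inl i) := by
      simp [blockExtend, Matrix.mulVec, dotProduct, ← Finset.mul_sum, mul_add, mul_assoc]
    simp only [e, Sum.elim_inl, PiLp.sub_apply]
    rw [← mul_sub, mul_pow]
    exact mul_le_of_le_one_left (sq_nonneg _) (pow_le_one₀ hs0 hs1)
  · have e : (blockExtend (s • W) Y).transpose.mulVec t (Sum.inr i) =
        (blockExtend W Y).transpose.mulVec t (Sum.inr i) := by
      simp [blockExtend, Matrix.mulVec, dotProduct]
    simp only [e, Sum.elim_inr, PiLp.sub_apply]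
    rfl

theorem sum_transpose_mulVec {ι κ : Type*} [Fintype ι] [Fintype κ] (A : Matrix ι κ ℝ)
    (x : κ → ℝ) (t : ι → ℝ) :
    ∑ i, x i * A.transpose.mulVec t i = ∑ j, A.mulVec x j * t j := by
  have := Matrix.dotProduct_mulVec x A.transpose t
  rw [Matrix.vecMul_transpose] at this
  exact this

open Complex in
/-- Esseen's inequality for `[W | Y ⊕ Y]ᵀ τ`. -/
theorem measureReal_norm_blockExtend_sub_le {Ω : Type*} [MeasurableSpace Ω] {P : Measure Ω}
    [IsProbabilityMeasure P] {n k m : ℕ} {T μ : ℝ} {ξ ξ' : Ω → Fin n → ℝ}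
    {τ : Ω → Fin n ⊕ Fin n → ℝ} (hξ : MemG P T ξ) (hcopy : IsIndepCopy P ξ ξ')
    (hτ : MemPhi P μ (pairVec ξ ξ') τ) (hμ0 : 0 ≤ μ) (hμ1 : μ ≤ 1)
    (W : Matrix (Fin n ⊕ Fin n) (Fin k) ℝ) (Y : Matrix (Fin n) (Fin m) ℝ) {s : ℝ} (hs0 : 0 ≤ s)
    (hs1 : s ≤ 1) (w : EuclideanSpace ℝ (Fin k ⊕ (Fin m ⊕ Fin m))) (t : ℝ) :
    ENNReal.ofReal (P.real {ω | ‖WithLp.toLp 2 ((blockExtend W Y).transpose.mulVec (τ ω)) - w‖ ≤ t})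
      ≤ ENNReal.ofReal (Real.exp (Real.pi * t ^ 2)) *
        ∫⁻ x : Fin k ⊕ (Fin m ⊕ Fin m) → ℝ, ENNReal.ofReal (Real.exp (-Real.pi * ∑ i, x i ^ 2) *
          Real.exp (-(4 * μ) * sqDist (Sum.elim (fun i => symmLaw P fun ω => ξ ω i)
            (fun i => symmLaw P fun ω => ξ ω i)) ((blockExtend (s • W) Y).mulVec x))) := by
  have hτm : AEMeasurable τ P := by
    obtain ⟨δ, hδm, -, -, -, h⟩ := hτ
    refine aemeasurable_pi_iff.2 fun j => ?_
    have hη : AEMeasurable (fun ω => pairVec ξ ξ' ω j) P := by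
      rcases j with i | i
      · exact (hξ.memS2 i).aemeasurable
      · exact aemeasurable_pi_iff.1 hcopy.identDistrib.aemeasurable_fst i
    exact ((hδm j).mul hη).congr (Filter.EventuallyEq.symm (h j))
  let w' : Fin k ⊕ (Fin m ⊕ Fin m) → ℝ :=
    Sum.elim (fun i => s * w (Sum.inl i)) (fun i => w (Sum.inr i))
  let g : (Fin n ⊕ Fin n → ℝ) → (Fin k ⊕ (Fin m ⊕ Fin m) → ℝ) := fun t =>
    (blockExtend (s • W) Y).transpose.mulVec t - w'
  have hg : Continuous g := (continuous_const.matrix_mulVec continuous_id).sub continuous_const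
  have hgm : AEMeasurable (fun ω => g (τ ω)) P := hg.measurable.comp_aemeasurable hτm
  have hprob : IsProbabilityMeasure (P.map fun ω => g (τ ω)) :=
    Measure.isProbabilityMeasure_map hgm
  have hmeas : MeasurableSet {z : Fin k ⊕ (Fin m ⊕ Fin m) → ℝ | ∑ i, z i ^ 2 ≤ t ^ 2} :=
    measurableSet_le (by fun_prop) measurable_const
  have h1 : P.real {ω | ‖WithLp.toLp 2 ((blockExtend W Y).transpose.mulVec (τ ω)) - w‖ ≤ t} ≤
      (P.map fun ω => g (τ ω)).real {z | ∑ i, z i ^ 2 ≤ t ^ 2} := by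
    rw [map_measureReal_apply_of_aemeasurable hgm hmeas]
    refine measureReal_mono fun ω hω => ?_
    exact (norm_blockExtend_sub_sq_ge W Y hs0 hs1 (τ ω) w).trans
      (pow_le_pow_left₀ (norm_nonneg _) hω 2)
  refine (ENNReal.ofReal_le_ofReal h1).trans
    ((measureReal_ball_le_integral_charFun (P.map fun ω => g (τ ω)) t).trans ?_)
  refine mul_le_mul_right (lintegral_mono fun x => ENNReal.ofReal_le_ofReal ?_) _
  refine mul_le_mul_of_nonneg_left ?_ (Real.exp_pos _).le
  refine le_trans (le_of_eq ?_) (norm_integral_cexp_le_exp_neg_sqDist hξ hcopy hτ hμ0 hμ1 _)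
  rw [integral_map hgm (Continuous.aestronglyMeasurable (by fun_prop))]
  -- The shift `w'` contributes only a unimodular phase, so the bound is uniform in `w`.
  have e : ∀ ω, cexp ((2 * Real.pi * ∑ i, x i * g (τ ω) i : ℝ) * I) =
      cexp ((-(2 * Real.pi * ∑ i, x i * w' i) : ℝ) * I) *
        cexp ((2 * Real.pi * ∑ j, (blockExtend (s • W) Y).mulVec x j * τ ω j : ℝ) * I) := by
    intro ω
    rw [← Complex.exp_add, ← sum_transpose_mulVec]
    congr 1
    simp only [g, Pi.sub_apply, mul_sub, Finset.sum_sub_distrib]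
    push_cast
    ring
  simp only [e]
  rw [integral_const_mul, norm_mul, Complex.norm_exp_ofReal_mul_I, one_mul]

end SmallBall

/-! ### Constants and conclusion. -/

namespace SmallBall

/-- The numerical comparison of the constants. -/
theorem numerical_bound {k m : ℕ} (hm : 0 < m) {T μ γ α c₀ B S : ℝ} (hT : 1 ≤ T) (hμ : 0 < μ)
    (hμ1 : μ ≤ 1) (hγ : 0 < γ) (hα : 0 < α) (hB : 0 < B) (hc₀ : 0 < c₀)
    (hc : c₀ < 1 / 41943040 * T ^ (-4 : ℤ) * μ) (hS : k / 4 / (262144 * T ^ 4) ≤ S) :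
    Real.exp (Real.pi * (√c₀ * √((k : ℝ) + m)) ^ 2) *
      ((2 * Real.exp (2 * Real.pi)) ^ m * Real.exp (1 / 2) *
        Real.exp (4 * μ * (4 / (262144 * T ^ 4)) / 128 / Real.pi * k -
          255 / 1024 / Real.pi * (4 * μ) * S) *
        ((2 * Real.pi * γ / α) ^ (2 * m) / B)) ≤
      (2 * Real.pi * Real.exp 5 * γ * α⁻¹) ^ (2 * m) / B * Real.exp (-(c₀ * k)) := by
  have hπ := Real.pi_pos
  have hπ3 := Real.pi_gt_three
  have hπ4 := Real.pi_lt_d2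
  have hT0 : 0 < T := by linarith
  -- Here `u = μ s²` for the scaling `s = 1/(512 T²)`, and `41943040 = 160 * 262144`, so `hc` reads
  -- `c₀ < u/160`.
  set u := μ / (262144 * T ^ 4) with hu
  have hu0 : 0 < u := by positivity
  have hu1 : u ≤ 1 / 262144 := by
    rw [hu, div_le_div_iff₀ (by positivity) (by positivity)]
    have := one_le_pow₀ hT (n := 4)
    nlinarith
  have hcu : c₀ < u / 160 := by
    refine hc.trans_eq ?_
    rw [hu, zpow_neg]
    norm_cast
    field_simp
    norm_num
  have hm1 : (1 : ℝ) ≤ m := by exact_mod_cast hm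
  have e1 : (√c₀ * √((k : ℝ) + m)) ^ 2 = c₀ * (k + m) := by
    rw [mul_pow, Real.sq_sqrt hc₀.le, Real.sq_sqrt (by positivity)]
  have e2 : (2 * Real.exp (2 * Real.pi)) ^ m ≤ Real.exp ((1 + 2 * Real.pi) * m) := by
    rw [mul_comm _ (m : ℝ), Real.exp_nat_mul]
    refine pow_le_pow_left₀ (by positivity) ?_ m
    rw [Real.exp_add]
    gcongr
    have := Real.add_one_le_exp (1 : ℝ)
    linarith
  have e3 : (2 * Real.pi * Real.exp 5 * γ * α⁻¹) ^ (2 * m) =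
      Real.exp (10 * m) * (2 * Real.pi * γ / α) ^ (2 * m) := by
    rw [show 2 * Real.pi * Real.exp 5 * γ * α⁻¹ = Real.exp 5 * (2 * Real.pi * γ / α) by
      field_simp, mul_pow, ← Real.exp_nat_mul]
    congr 2
    push_cast
    ring
  have hSu : u * (k / 4) ≤ μ * S := by
    refine le_trans (le_of_eq ?_) (mul_le_mul_of_nonneg_left hS hμ.le)
    rw [hu]
    field_simp
  -- In `k`, the gain `uk/32` beats the loss `(π + 1) c₀ k`, as `c₀ < u/160`. In `m`, the loss is at
  -- most `m + (1 + 2π)m + 1/2 ≤ 10m`, the exponent that `exp 5` in the final constant provides.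
  have hexp : Real.pi * (c₀ * (k + m)) + (1 + 2 * Real.pi) * m + 1 / 2 +
      (4 * μ * (4 / (262144 * T ^ 4)) / 128 / Real.pi * k - 255 / 1024 / Real.pi * (4 * μ) * S) ≤
      10 * m + -(c₀ * k) := by
    have f1 : 4 * μ * (4 / (262144 * T ^ 4)) / 128 / Real.pi * k = u * k / 8 / Real.pi := by
      rw [hu]
      field_simp
      ring
    have f2 : 255 / 1024 / Real.pi * (4 * μ) * S = 255 / 256 * (μ * S) / Real.pi := by
      field_simp
      ring
    have f3 : u * k / 8 / Real.pi - 255 / 256 * (μ * S) / Real.pi ≤ -(u * k / 32) := by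
      rw [← sub_div, div_le_iff₀ hπ]
      have : 0 ≤ u * k := by positivity
      nlinarith
    rw [f1, f2]
    have f4 : c₀ * k ≤ u * k / 160 := by
      have := mul_le_mul_of_nonneg_right hcu.le (Nat.cast_nonneg k : (0 : ℝ) ≤ k)
      linarith
    have f5 : Real.pi * (c₀ * k) ≤ 3.15 * (c₀ * k) := by gcongr
    have f6 : Real.pi * (c₀ * m) ≤ m := by
      have : c₀ ≤ 1 / 4 := by linarith
      have : Real.pi * c₀ ≤ 1 := by nlinarith
      nlinarith
    have f7 : 0 ≤ c₀ * k := by positivity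
    nlinarith
  calc _ ≤ Real.exp (Real.pi * (c₀ * (k + m))) *
      (Real.exp ((1 + 2 * Real.pi) * m) * Real.exp (1 / 2) *
        Real.exp (4 * μ * (4 / (262144 * T ^ 4)) / 128 / Real.pi * k -
          255 / 1024 / Real.pi * (4 * μ) * S) *
        ((2 * Real.pi * γ / α) ^ (2 * m) / B)) := by
        rw [e1]
        gcongr
    _ = Real.exp (Real.pi * (c₀ * (k + m)) + (1 + 2 * Real.pi) * m + 1 / 2 +
      (4 * μ * (4 / (262144 * T ^ 4)) / 128 / Real.pi * k -
        255 / 1024 / Real.pi * (4 * μ) * S)) * ((2 * Real.pi * γ / α) ^ (2 * m) / B) := by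
        simp only [Real.exp_add]
        ring
    _ ≤ Real.exp (10 * m + -(c₀ * k)) * ((2 * Real.pi * γ / α) ^ (2 * m) / B) := by
        gcongr
    _ = _ := by
        rw [e3, Real.exp_add]
        ring

end SmallBall

theorem mainTheorem10 :
    ∃ d c C : ℝ, 0 < d ∧ 0 < c ∧ 0 < C ∧
      ∀ (T : ℝ) (n k m : ℕ) (α μ : ℝ), 1 ≤ T → 0 < m → 0 < α → α < 1 → 0 < μ → μ ≤ 1 →
      ∀ {Ω : Type*} [MeasurableSpace Ω] (P : Measure Ω) [IsProbabilityMeasure P]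
        (ξ ξ' : Ω → Fin n → ℝ) (τ : Ω → Fin n ⊕ Fin n → ℝ),
        SmallBall.MemG P T ξ →
        SmallBall.IsIndepCopy P ξ ξ' →
        SmallBall.MemPhi P μ (SmallBall.pairVec ξ ξ') τ →
      ∀ (Y : Matrix (Fin n) (Fin m) ℝ) (W : Matrix (Fin n ⊕ Fin n) (Fin k) ℝ),
        (∀ i, Y.col i ≠ 0) →
        SmallBall.opNorm W ≤ 2 →
        √(k : ℝ) / 2 ≤ SmallBall.hsNorm W →
      ∀ γ c₀ : ℝ, d * T ^ 2 * μ ^ (-(1 / 2) : ℝ) ≤ γ →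
        0 < c₀ → c₀ < c * T ^ (-4 : ℤ) * μ →
        ENNReal.ofReal (16 * √(m : ℝ)) <
          SmallBall.RlogD P ξ (γ * √(m : ℝ)) α Y.transpose →
        SmallBall.levy P
            (fun ω => WithLp.toLp 2 (Matrix.mulVec (SmallBall.blockExtend W Y).transpose (τ ω)))
            (√c₀ * √((k : ℝ) + m)) ≤
          (C * γ * α⁻¹) ^ (2 * m) / (∏ i, ‖WithLp.toLp 2 (Y.col i)‖ ^ 2) *
            Real.exp (-(c₀ * k)) := by
  refine ⟨32, 1 / 41943040, 2 * Real.pi * Real.exp 5, by norm_num, by norm_num, by positivity, ?_⟩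
  intro T n k m α μ hT hm hα hα1 hμ hμ1 Ω _ P _ ξ ξ' τ hξ hcopy hτ Y W hY hW hHS γ c₀ hγ hc₀ hc hR
  have hT0 : 0 < T := by linarith
  have hμr : 0 < μ ^ (-(1 / 2) : ℝ) := Real.rpow_pos_of_pos hμ _
  have hγ0 : 0 < γ := lt_of_lt_of_le (by positivity) hγ
  -- This fixes `d = 32`: with `p = 4μ`, the Cauchy domination needs `μγ² ≥ 1024 = 32²`.
  have hγ2 : 2 * 2048 ≤ 4 * μ * γ ^ 2 := by
    have h1 := pow_le_pow_left₀ (by positivity) hγ 2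
    have h2 : (μ ^ (-(1 / 2) : ℝ)) ^ 2 = μ⁻¹ := by
      rw [← Real.rpow_natCast, ← Real.rpow_mul hμ.le, ← Real.rpow_neg_one]
      norm_num
    rw [mul_pow, mul_pow, h2] at h1
    have h3 := mul_le_mul_of_nonneg_left h1 hμ.le
    have h4 : μ * (32 ^ 2 * (T ^ 2) ^ 2 * μ⁻¹) = 1024 * T ^ 4 := by
      field_simp
      norm_num
    have h5 := one_le_pow₀ hT (n := 4)
    linarith
  have hy : ∀ i, 0 < ‖WithLp.toLp 2 (Y.col i)‖ := fun i => by
    rw [norm_pos_iff]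
    intro h
    exact hY i (by simpa using h)
  -- The scaling makes rows short against the fourth-moment bound `1024 T⁴`: the condition on `s •
  -- W` becomes `π²/32 ≤ 1`. It is also the source of `T⁻⁴` in the bound on `c₀`.
  set s : ℝ := 1 / (512 * T ^ 2) with hs
  have hs0 : 0 < s := by positivity
  have hT2 := one_le_pow₀ hT (n := 2)
  have hs1 : s ≤ 1 := by
    rw [hs, div_le_one (by positivity)]
    linarith
  have hs2 : s ^ 2 = 1 / (262144 * T ^ 4) := by
    rw [hs]
    field_simp
    norm_num
  let ν : Fin n → Measure ℝ := fun i => SmallBall.symmLaw P fun ω => ξ ω i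
  have hν : ∀ i, IsProbabilityMeasure (ν i) := fun i =>
    SmallBall.isProbabilityMeasure_symmLaw (hξ.memS2 i).aemeasurable
  have hrow : ∀ j, ∑ i, (s • W) j i ^ 2 ≤ 4 * s ^ 2 := fun j => by
    have h1 := SmallBall.sum_row_sq_le_of_opNorm_le hW j
    simp only [Matrix.smul_apply, smul_eq_mul, mul_pow, ← Finset.mul_sum]
    nlinarith [sq_nonneg s]
  have hT4 := one_le_pow₀ hT (n := 4)
  have hS : k / 4 / (262144 * T ^ 4) ≤ ∑ j, ∑ i, (s • W) j i ^ 2 := by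
    have h1 := pow_le_pow_left₀ (by positivity) hHS 2
    rw [SmallBall.hsNorm, Real.sq_sqrt (by positivity), div_pow,
      Real.sq_sqrt (Nat.cast_nonneg k)] at h1
    simp only [Matrix.smul_apply, smul_eq_mul, mul_pow, ← Finset.mul_sum]
    rw [hs2, one_div, inv_mul_eq_div]
    gcongr
    linarith
  have hmain := SmallBall.lintegral_gaussian_blockExtend_le hm ν (p := 4 * μ)
    (M := 1024 * T ^ 4) (r := 4 * s ^ 2) hγ0 hα (by positivity) hγ2 (by positivity)
    (by
      rw [hs2]
      have : 4 * (1 / (262144 * T ^ 4)) ≤ 1 / 32 := by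
        rw [mul_one_div, div_le_div_iff₀ (by positivity) (by norm_num)]
        linarith
      nlinarith)
    (fun i => ((hξ.memS2 i).symmLaw_sq hT).1) (fun i => ((hξ.memS2 i).symmLaw_sq hT).2)
    (fun i => ((hξ.memS2 i).symmLaw_pow_four hT).1)
    (fun i => ((hξ.memS2 i).symmLaw_pow_four hT).2) (s • W)
    (fun j => by
      calc 2 * Real.pi ^ 2 * (∑ i, (s • W) j i ^ 2) * (1024 * T ^ 4)
          ≤ 2 * Real.pi ^ 2 * (4 * s ^ 2) * (1024 * T ^ 4) := by
            gcongr
            exact hrow j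
        _ = Real.pi ^ 2 / 32 := by
            rw [hs2]
            field_simp
            norm_num
        _ ≤ 1 := by nlinarith [Real.pi_lt_d2, Real.pi_pos])
    (fun z => by
      have h1 := SmallBall.sum_mulVec_sq_le_of_opNorm_le hW z
      simp only [Matrix.smul_mulVec, Pi.smul_apply, smul_eq_mul, mul_pow, ← Finset.mul_sum]
      have h2 := mul_le_mul_of_nonneg_left h1 (sq_nonneg s)
      linarith)
    Y hy (fun z hz => by
      rw [← SmallBall.xiNorm_sq fun i => (hξ.memS2 i).aemeasurable]
      exact SmallBall.posLog_le_xiNorm_of_lt_RlogD hγ0.le hR z hz)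
  refine ciSup_le fun w => ?_
  have hE := SmallBall.measureReal_norm_blockExtend_sub_le hξ hcopy hτ hμ.le hμ1 W Y hs0.le hs1 w
    (√c₀ * √((k : ℝ) + m))
  have hprod : 0 < ∏ i, ‖WithLp.toLp 2 (Y.col i)‖ ^ 2 :=
    Finset.prod_pos fun i _ => pow_pos (hy i) 2
  have hfin := hE.trans (mul_le_mul_right hmain _)
  rw [← ENNReal.ofReal_mul (by positivity),
    ENNReal.ofReal_le_ofReal_iff (by positivity)] at hfin
  refine hfin.trans ?_
  rw [hs2, mul_one_div]
  exact SmallBall.numerical_bound hm hT hμ hμ1 hγ0 hα hprod hc₀ hc hS
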